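/- Let $d\in\mathbb N$, let $R\subseteq\mathbb R^d$ be a convex subset whose interior $R^0$ is dense in $R$, let $\ell\in\mathbb N_0\cup\{\infty\}$, and let $F$ be a complete Hausdorff locally convex real topological vector space (every Cauchy net converges). For a Hausdorff locally convex real topological vector space $Y$, let $C^\ell(R,Y)$ be the vector space of all continuous functions $\gamma\colon R\to Y$ such that for each multi-index $\alpha\in\mathbb N_0^d$ with $|\alpha|\le\ell$ the partial derivative $\partial^\alpha(\gamma|_{R^0})=\frac{\partial^{\alpha_1}}{\partial x_1^{\alpha_1}}\cdots\frac{\partial^{\alpha_d}}{\partial x_d^{\alpha_d}}(\gamma|_{R^0})$ exists on $R^0$ and extends to a (necessarily unique) continuous function $\partial^\alpha\gamma\colon R\to Y$. Endow $C^\ell(R,Y)$ with the compact-open $C^\ell$-topology, i.e. the initial topology with respect to the maps $C^\ell(R,Y)\to C(R,Y)$, $\gamma\mapsto\partial^\alpha\gamma$ for $|\alpha|\le\ell$, where the space $C(R,Y)$ of continuous functions carries the compact-open topology. For Hausdorff locally convex spaces $E$ and $G$, let $E'_\tau$ be the dual of $E$ with the Mackey topology (uniform convergence on the absolutely convex weakly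 compact subsets of $E$), and let $\mathcal L(E'_\tau,G)_\varepsilon$ be the space of continuous linear maps $E'_\tau\to G$ with the topology of uniform convergence on equicontinuous subsets of $E'$. The $\varepsilon$-topology on $E\otimes G$ is the initial topology with respect to the linear map $\psi\colon E\otimes G\to\mathcal L(E'_\tau,G)_\varepsilon$ determined by $\psi(x\otimes y)(\lambda)=\lambda(x)y$, and $E\,\widetilde\otimes_\varepsilon\,G$ denotes the completion of $E\otimes G$ with respect to this topology. Then \[ C^\ell(R,F)\;\cong\;F\,\widetilde\otimes_\varepsilon\,C^\ell(R,\mathbb R) \] as locally convex spaces. More precisely, there is an isomorphism of topological vector spaces $\Lambda\colon C^\ell(R,F)\to F\,\widetilde\otimes_\varepsilon\,C^\ell(R,\mathbb R)$ such that, for all $v\in F$ and $\gamma\in C^\ell(R,\mathbb R)$, the element $\Lambda^{-1}(v\otimes\gamma)$ is the function $R\to F$, $x\mapsto\gamma(x)v$. -/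

import Mathlib

open Filter Topology
open scoped TensorProduct

noncomputable section

/-! ### Iterated partial derivatives of functions on `ℝ^d` with values in a locally convex space

`ℝ^d` is `Fin d → ℝ`; only its topology and its vector space structure are used. -/

theorem extend_val_add {d : ℕ} {F : Type*} [AddCommGroup F] {R : Set (Fin d → ℝ)} (γ η : R → F) :
    Function.extend Subtype.val (γ + η) 0 =
      Function.extend Subtype.val γ 0 + Function.extend (Subtype.val : R → _) η 0 := by
  rw [← Function.extend_add, add_zero]

theorem extend_val_smul {d : ℕ} {F : Type*} [AddCommGroup F] [Module ℝ F]
    {R : Set (Fin d → ℝ)} (c : ℝ) (γ : R → F) :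
    Function.extend Subtype.val (c • γ) 0 =
      c • Function.extend (Subtype.val : R → _) γ (0 : (Fin d → ℝ) → F) := by
  rw [← Function.extend_smul, smul_zero]

section PartialDerivatives

variable {d : ℕ} {F : Type*} [AddCommGroup F] [Module ℝ F] [TopologicalSpace F]

/-- `y` is the `i`-th partial derivative of `f` at `x`, i.e. the limit of the difference
quotients `(f (x + t e_i) - f x) / t` as `t → 0`, `t ≠ 0`. -/
def HasPartialDerivAt (i : Fin d) (f : (Fin d → ℝ) → F) (y : F) (x : Fin d → ℝ) : Prop :=
  Tendsto (fun t : ℝ => t⁻¹ • (f (x + Pi.single i t) - f x)) (𝓝[≠] 0) (𝓝 y)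

/-- For a word `w = i₁ i₂ … i_k`: on the set `U` the iterated partial derivative
`∂_{i₁} (∂_{i₂} (⋯ (∂_{i_k} f)))` exists and equals `g`. Only meant for open `U`. -/
def HasIteratedPartialOn (U : Set (Fin d → ℝ)) :
    List (Fin d) → ((Fin d → ℝ) → F) → ((Fin d → ℝ) → F) → Prop
  | [], f, g => Set.EqOn g f U
  | i :: w, f, g => ∃ h : (Fin d → ℝ) → F,
      HasIteratedPartialOn U w f h ∧ ∀ x ∈ U, HasPartialDerivAt i h (g x) x

/-- The word `1…1 2…2 ⋯ d…d` in which the letter `i` occurs `α i` times, so that the iterated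
partial derivative along it is `∂^α = ∂_1^{α_1} ⋯ ∂_d^{α_d}`. -/
def multiIndexWord (α : Fin d → ℕ) : List (Fin d) :=
  (List.finRange d).flatMap fun i => List.replicate (α i) i

/-- For `γ : R → F`: the partial derivative `∂^α (γ|_{R°})` exists on the interior `R°`, and
`g : R → F` is a continuous function which extends it. (The extension of the functions by `0`
outside `R` only serves to make them total; it is irrelevant on the open set `R°`.) -/
def IsPartialExtension {R : Set (Fin d → ℝ)} (α : Fin d → ℕ) (γ g : C(R, F)) : Prop :=
  HasIteratedPartialOn (interior R) (multiIndexWord α)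
    (Function.extend Subtype.val γ 0) (Function.extend Subtype.val g 0)

theorem HasPartialDerivAt.add [IsTopologicalAddGroup F] {i : Fin d} {f f' : (Fin d → ℝ) → F}
    {y y' : F} {x : Fin d → ℝ} (h : HasPartialDerivAt i f y x) (h' : HasPartialDerivAt i f' y' x) :
    HasPartialDerivAt i (f + f') (y + y') x := by
  refine (Tendsto.add h h').congr fun t => ?_
  simp only [Pi.add_apply, ← smul_add]
  congr 1
  abel

theorem HasPartialDerivAt.const_smul [ContinuousConstSMul ℝ F] {i : Fin d}
    {f : (Fin d → ℝ) → F} {y : F} {x : Fin d → ℝ} (c : ℝ) (h : HasPartialDerivAt i f y x) :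
    HasPartialDerivAt i (c • f) (c • y) x := by
  refine (Tendsto.const_smul h c).congr fun t => ?_
  simp only [Pi.smul_apply, ← smul_sub, smul_comm c]

theorem HasIteratedPartialOn.add [IsTopologicalAddGroup F] {U : Set (Fin d → ℝ)}
    {w : List (Fin d)} {f f' g g' : (Fin d → ℝ) → F} (h : HasIteratedPartialOn U w f g)
    (h' : HasIteratedPartialOn U w f' g') : HasIteratedPartialOn U w (f + f') (g + g') := by
  induction w generalizing g g' with
  | nil => exact fun x hx => congrArg₂ (· + ·) (h hx) (h' hx)
  | cons i w ih =>
    obtain ⟨k, hk, hkg⟩ := h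
    obtain ⟨k', hk', hkg'⟩ := h'
    exact ⟨k + k', ih hk hk', fun x hx => (hkg x hx).add (hkg' x hx)⟩

theorem HasIteratedPartialOn.const_smul [ContinuousConstSMul ℝ F] {U : Set (Fin d → ℝ)}
    {w : List (Fin d)} {f g : (Fin d → ℝ) → F} (c : ℝ) (h : HasIteratedPartialOn U w f g) :
    HasIteratedPartialOn U w (c • f) (c • g) := by
  induction w generalizing g with
  | nil => exact fun x hx => congrArg (c • ·) (h hx)
  | cons i w ih =>
    obtain ⟨k, hk, hkg⟩ := h
    exact ⟨c • k, ih hk, fun x hx => (hkg x hx).const_smul c⟩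

theorem HasIteratedPartialOn.eqOn [T2Space F] {U : Set (Fin d → ℝ)} (hU : IsOpen U)
    {w : List (Fin d)} {f g g' : (Fin d → ℝ) → F} (h : HasIteratedPartialOn U w f g)
    (h' : HasIteratedPartialOn U w f g') : Set.EqOn g g' U := by
  induction w generalizing g g' with
  | nil => exact h.trans h'.symm
  | cons i w ih =>
    obtain ⟨k, hk, hkg⟩ := h
    obtain ⟨k', hk', hkg'⟩ := h'
    intro x hx
    have hkk := ih hk hk'
    refine tendsto_nhds_unique_of_eventuallyEq (hkg x hx) (hkg' x hx) ?_
    have hc : Tendsto (fun t : ℝ => x + Pi.single i t) (𝓝[≠] 0) (𝓝 x) := by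
      have : Continuous fun t : ℝ => x + (Pi.single i t : Fin d → ℝ) :=
        continuous_const.add (continuous_const.update i continuous_id)
      simpa using (this.tendsto 0).mono_left nhdsWithin_le_nhds
    filter_upwards [hc.eventually (hU.mem_nhds hx)] with t ht
    rw [hkk ht, hkk hx]

theorem IsPartialExtension.add [IsTopologicalAddGroup F] {R : Set (Fin d → ℝ)} {α : Fin d → ℕ}
    {γ η g h : C(R, F)} (hg : IsPartialExtension α γ g) (hh : IsPartialExtension α η h) :
    IsPartialExtension α (γ + η) (g + h) := by
  have := HasIteratedPartialOn.add hg hh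
  rwa [← extend_val_add, ← extend_val_add] at this

theorem IsPartialExtension.const_smul [ContinuousConstSMul ℝ F] {R : Set (Fin d → ℝ)}
    {α : Fin d → ℕ} {γ g : C(R, F)} (c : ℝ) (hg : IsPartialExtension α γ g) :
    IsPartialExtension α (c • γ) (c • g) := by
  have := HasIteratedPartialOn.const_smul c hg
  rwa [← extend_val_smul, ← extend_val_smul] at this

/-- The continuous extension of `∂^α (γ|_{R°})` is unique if `R°` is dense in `R`. -/
theorem IsPartialExtension.unique [T2Space F] {R : Set (Fin d → ℝ)}
    (hR : R ⊆ closure (interior R)) {α : Fin d → ℕ} {γ g h : C(R, F)}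
    (hg : IsPartialExtension α γ g) (hh : IsPartialExtension α γ h) : g = h := by
  have hEq := HasIteratedPartialOn.eqOn isOpen_interior hg hh
  have hd : Dense {x : R | (x : Fin d → ℝ) ∈ interior R} := by
    intro x
    rw [closure_subtype]
    refine closure_mono ?_ (hR x.2)
    exact fun y hy => ⟨⟨y, interior_subset hy⟩, hy, rfl⟩
  refine DFunLike.coe_injective (Continuous.ext_on hd g.continuous h.continuous fun x hx => ?_)
  have := hEq hx
  rwa [Subtype.val_injective.extend_apply, Subtype.val_injective.extend_apply] at this

end PartialDerivatives

/-! ### The space `C^ℓ(R, F)` with the compact-open `C^ℓ`-topology -/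

section FunctionSpace

variable {d : ℕ} (R : Set (Fin d → ℝ)) (hR : R ⊆ closure (interior R)) (ℓ : ℕ∞)
  (F : Type*) [AddCommGroup F] [Module ℝ F] [TopologicalSpace F] [IsTopologicalAddGroup F]
  [ContinuousSMul ℝ F]

/-- The vector space of all continuous `γ : R → F` such that for all multi-indices `α` with
`|α| ≤ ℓ` the partial derivative `∂^α (γ|_{R°})` exists on the interior `R°` and extends to a
continuous function on `R`. -/
def cEllSubmodule : Submodule ℝ C(R, F) where
  carrier := {γ | ∀ α : Fin d → ℕ, ((∑ i, α i : ℕ) : ℕ∞) ≤ ℓ →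
    ∃ g : C(R, F), IsPartialExtension α γ g}
  add_mem' {γ η} hγ hη α hα := by
    obtain ⟨g, hg⟩ := hγ α hα
    obtain ⟨h, hh⟩ := hη α hα
    exact ⟨g + h, hg.add hh⟩
  zero_mem' α _ := by
    refine ⟨0, ?_⟩
    have h0 : ∀ w : List (Fin d), HasIteratedPartialOn (F := F) (interior R) w 0 0 := by
      intro w
      induction w with
      | nil => exact fun x _ => rfl
      | cons i w ih => exact ⟨0, ih, fun x _ => by simp [HasPartialDerivAt, tendsto_const_nhds]⟩
    have hz : Function.extend (Subtype.val : R → _) (0 : R → F) 0 = 0 :=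
      Function.extend_zero _
    have := h0 (multiIndexWord α)
    rw [← hz] at this
    exact this
  smul_mem' c {γ} hγ α hα := by
    obtain ⟨g, hg⟩ := hγ α hα
    exact ⟨c • g, hg.const_smul c⟩

/-- The space `C^ℓ(R, F)`, for a set `R ⊆ ℝ^d` whose interior is dense in `R`. This is a type
of its own, so that it does not inherit the subspace topology from `C(R, F)`. -/
def CEll (_ : R ⊆ closure (interior R)) : Type _ := ↥(cEllSubmodule R ℓ F)

namespace CEll

instance : AddCommGroup (CEll R ℓ F hR) := inferInstanceAs (AddCommGroup (cEllSubmodule R ℓ F))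

instance : Module ℝ (CEll R ℓ F hR) := inferInstanceAs (Module ℝ (cEllSubmodule R ℓ F))

instance : FunLike (CEll R ℓ F hR) R F where
  coe γ := γ.1
  coe_injective _ _ h := Subtype.ext (DFunLike.coe_injective h)

variable {R hR ℓ F}

/-- The continuous extension `∂^α γ : R → F` of `∂^α (γ|_{R°})`. -/
def partialFun (α : {α : Fin d → ℕ // ((∑ i, α i : ℕ) : ℕ∞) ≤ ℓ}) (γ : CEll R ℓ F hR) :
    C(R, F) :=
  (γ.2 α.1 α.2).choose

theorem partialFun_spec (α : {α : Fin d → ℕ // ((∑ i, α i : ℕ) : ℕ∞) ≤ ℓ})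
    (γ : CEll R ℓ F hR) : IsPartialExtension α.1 γ.1 (partialFun α γ) :=
  (γ.2 α.1 α.2).choose_spec

variable [T2Space F]

/-- The linear map `∂^α : C^ℓ(R, F) → C(R, F)`, for `|α| ≤ ℓ`. -/
def partialLM (α : {α : Fin d → ℕ // ((∑ i, α i : ℕ) : ℕ∞) ≤ ℓ}) :
    CEll R ℓ F hR →ₗ[ℝ] C(R, F) where
  toFun := partialFun α
  map_add' γ η := (partialFun_spec α (γ + η)).unique hR
    ((partialFun_spec α γ).add (partialFun_spec α η))
  map_smul' c γ := (partialFun_spec α (c • γ)).unique hR ((partialFun_spec α γ).const_smul c)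

/-- The compact-open `C^ℓ`-topology: the initial topology with respect to the maps
`∂^α : C^ℓ(R, F) → C(R, F)`, `|α| ≤ ℓ`, where `C(R, F)` carries the compact-open topology. -/
instance : TopologicalSpace (CEll R ℓ F hR) :=
  ⨅ α : {α : Fin d → ℕ // ((∑ i, α i : ℕ) : ℕ∞) ≤ ℓ},
    TopologicalSpace.induced (partialLM α) inferInstance

instance : IsTopologicalAddGroup (CEll R ℓ F hR) :=
  topologicalAddGroup_iInf fun α => topologicalAddGroup_induced (partialLM α)

instance : ContinuousSMul ℝ (CEll R ℓ F hR) :=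
  continuousSMul_iInf fun α => continuousSMul_induced (partialLM α)

end CEll

end FunctionSpace

/-! ### The completed `ε`-tensor product of locally convex spaces -/

section EpsilonTensor

section

variable (E : Type*) [AddCommGroup E] [Module ℝ E] [TopologicalSpace E]

/-- The dual `E'_τ` with the Mackey topology: the space of continuous linear functionals on `E`
with the topology of uniform convergence on the absolutely convex, weakly compact subsets
of `E`. -/
abbrev MackeyDual : Type _ :=
  UniformConvergenceCLM (RingHom.id ℝ) ℝ
    {S : Set E | AbsConvex ℝ S ∧ IsCompact (toWeakSpace ℝ E '' S)}

/-- The equicontinuous sets of continuous linear functionals on `E`. -/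
def equicontinuousSets : Set (Set (MackeyDual E)) :=
  {S | Equicontinuous fun (l : S) (x : E) => (l : MackeyDual E) x}

variable {E} in
/-- Point evaluations are continuous for the Mackey topology. -/
theorem MackeyDual.continuous_eval [IsTopologicalAddGroup E] [ContinuousSMul ℝ E] (x : E) :
    Continuous fun l : MackeyDual E => l x := by
  have hcov : ⋃₀ {S : Set E | AbsConvex ℝ S ∧ IsCompact (toWeakSpace ℝ E '' S)} = Set.univ := by
    refine Set.eq_univ_of_forall fun x => ?_
    let L : ℝ →ₗ[ℝ] E := LinearMap.toSpanSingleton ℝ E x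
    refine ⟨L '' Metric.closedBall 0 1, ⟨⟨?_, ?_⟩, ?_⟩, ⟨1, by simp, by simp [L]⟩⟩
    · rintro a ha _ ⟨_, ⟨t, ht, rfl⟩, rfl⟩
      refine ⟨a * t, ?_, by simp [L, mul_smul]⟩
      simp only [mem_closedBall_zero_iff, norm_mul] at ht ⊢
      exact mul_le_one₀ ha (norm_nonneg _) ht
    · exact (convex_closedBall 0 1).linear_image L
    · rw [← Set.image_comp]
      refine (isCompact_closedBall (0 : ℝ) 1).image ?_
      have : Continuous fun t : ℝ => t • x := by fun_prop
      exact (toWeakSpaceCLM ℝ E).continuous.comp this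
  have := UniformConvergenceCLM.continuousEvalConst (RingHom.id ℝ) ℝ _ hcov
  exact continuous_eval_const x

end

variable (E G : Type*) [AddCommGroup E] [Module ℝ E] [TopologicalSpace E]
  [IsTopologicalAddGroup E] [ContinuousSMul ℝ E] [AddCommGroup G] [Module ℝ G]
  [TopologicalSpace G] [IsTopologicalAddGroup G] [ContinuousSMul ℝ G]

/-- The space `L(E'_τ, G)_ε` of continuous linear maps `E'_τ → G`, with the topology of uniform
convergence on equicontinuous subsets of `E'`. -/
abbrev EpsHom : Type _ := UniformConvergenceCLM (RingHom.id ℝ) G (equicontinuousSets E)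

/-- The linear map `ψ : E ⊗ G → L(E'_τ, G)_ε` with `ψ (x ⊗ y) (l) = l(x) y`. -/
def epsMap : E ⊗[ℝ] G →ₗ[ℝ] EpsHom E G :=
  TensorProduct.lift <| LinearMap.mk₂ ℝ
    (fun x y => UniformConvergenceCLM.ofFun (RingHom.id ℝ) G (equicontinuousSets E)
      { toFun := fun l => l x • y
        map_add' := fun l m => by simp [add_smul]
        map_smul' := fun c l => by simp [mul_smul]
        cont := (MackeyDual.continuous_eval x).smul continuous_const })
    (fun x x' y => UniformConvergenceCLM.ext _ _ fun l =>
      show l (x + x') • y = l x • y + l x' • y by rw [map_add, add_smul])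
    (fun c x y => UniformConvergenceCLM.ext _ _ fun l =>
      show l (c • x) • y = c • (l x • y) by rw [map_smul, smul_eq_mul, mul_smul])
    (fun x y y' => UniformConvergenceCLM.ext _ _ fun l =>
      show l x • (y + y') = l x • y + l x • y' by rw [smul_add])
    (fun c x y => UniformConvergenceCLM.ext _ _ fun l =>
      show l x • (c • y) = c • (l x • y) by rw [smul_comm])

theorem epsMap_tmul_apply (x : E) (y : G) (l : MackeyDual E) :
    epsMap E G (x ⊗ₜ[ℝ] y) l = l x • y := rfl

/-- `E ⊗_ε G`: the algebraic tensor product `E ⊗ G` with the `ε`-topology. -/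
def EpsTensor : Type _ := E ⊗[ℝ] G

namespace EpsTensor

instance : AddCommGroup (EpsTensor E G) := inferInstanceAs (AddCommGroup (E ⊗[ℝ] G))

instance : Module ℝ (EpsTensor E G) := inferInstanceAs (Module ℝ (E ⊗[ℝ] G))

variable {E G} in
/-- The elementary tensor `x ⊗ y` in `E ⊗_ε G`. -/
def tmul (x : E) (y : G) : EpsTensor E G := x ⊗ₜ[ℝ] y

/-- The `ε`-topology is the initial topology with respect to `ψ`. -/
abbrev topology : TopologicalSpace (EpsTensor E G) :=
  TopologicalSpace.induced (epsMap E G) inferInstance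

theorem isTopologicalAddGroup : @IsTopologicalAddGroup _ (topology E G) _ :=
  topologicalAddGroup_induced (H := EpsTensor E G) (epsMap E G : EpsTensor E G →ₗ[ℝ] EpsHom E G)

/-- The uniform structure of the topological group `E ⊗_ε G`, whose topology is the
`ε`-topology. -/
instance : UniformSpace (EpsTensor E G) :=
  @IsTopologicalAddGroup.rightUniformSpace _ _ (topology E G) (isTopologicalAddGroup E G)

instance : IsUniformAddGroup (EpsTensor E G) :=
  @isUniformAddGroup_of_addCommGroup _ _ (topology E G) (isTopologicalAddGroup E G)

theorem toTopologicalSpace_eq :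
    (inferInstance : UniformSpace (EpsTensor E G)).toTopologicalSpace = topology E G := rfl

instance : ContinuousConstSMul ℝ (EpsTensor E G) where
  continuous_const_smul c := continuous_induced_rng.2 <| by
    have h : Continuous fun z : EpsTensor E G => (epsMap E G z : EpsHom E G) :=
      continuous_induced_dom
    refine (h.const_smul c).congr fun z => ?_
    exact ((epsMap E G).map_smul c z).symm

instance : UniformContinuousConstSMul ℝ (EpsTensor E G) :=
  uniformContinuousConstSMul_of_continuousConstSMul ℝ (EpsTensor E G)

end EpsTensor

/-- `E ⊗̃_ε G`: the (Hausdorff) completion of `E ⊗_ε G`. -/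
abbrev CompletedEpsTensor : Type _ := UniformSpace.Completion (EpsTensor E G)

end EpsilonTensor

end

/-!
The map `Φ : F ⊗ C^ℓ(R, ℝ) → C^ℓ(R, F)` with `Φ (v ⊗ γ) = γ(·) v` (`CEll.ofTensor`) induces the
`ε`-topology, its range is dense, and `C^ℓ(R, F)` is complete and Hausdorff. Hence `C^ℓ(R, F)` is
the completion of `F ⊗_ε C^ℓ(R, ℝ)`. All three facts are reduced to real-valued functions by the
Hahn–Banach theorem, in the form that a continuous seminorm `p` is the supremum of the functionals
`l` with `|l| ≤ p` (`Seminorm.le_of_forall_dual_le`).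

*Topology* (`CEll.comap_epsMap_nhds_zero`). The operator `ψ z` is `l ↦ l ∘ Φ z`, and
`∂^α (l ∘ Φ z) = l ∘ ∂^α (Φ z)`. So uniform smallness of `∂^α (ψ z l)` on a compact set, for the
functionals `l` dominated by `p`, is smallness of `∂^α (Φ z)` with respect to `p`.

*Completeness* (`CEll.isClosed_range_jet`). The map `γ ↦ (∂^α γ)_α` is an embedding into a product
of complete spaces `C(R, F)`. Its range is closed since a locally uniform limit of partial
derivatives is the partial derivative of the limit. For vector-valued functions this follows from
the real case, as a weak partial derivative which is continuous is a partial derivative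
(`hasPartialDerivAt_of_forall_dual`).

*Density* (`CEll.exists_ofTensor_approx`). Let `a` be an interior point of `R`. By convexity, the
dilation `u(x) = f(a + t(x - a))` with `t < 1` is defined and `C^ℓ` on an open neighbourhood of `R`,
and it is close to `f` for `t` near `1`. On a compact set, `u` is uniformly approximated by some
`∑ j, χ j · c j`, with continuous `χ j : ℝ^d → ℝ` of compact support and `c j` in `F`. For a
mollifier `φ`, the function `∑ j, (φ ⋆ χ j) · c j` lies in the range of `Φ`, and its derivative of
order `α` is close to `∂^α φ ⋆ u = φ ⋆ ∂^α u`, which is close to `∂^α u` (`exists_smooth_approx`).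
-/

noncomputable section

/-! ### Continuous seminorms and functionals on a locally convex space -/

/-- The Hahn–Banach theorem, applied to the functional `c • x ↦ c * p x` on the line through
`x`. -/
theorem Seminorm.exists_dual_apply_eq {E : Type*} [AddCommGroup E] [Module ℝ E]
    [TopologicalSpace E] [PolynormableSpace ℝ E] {p : Seminorm ℝ E} (hp : Continuous p) (x : E) :
    ∃ l : StrongDual ℝ E, (∀ y, |l y| ≤ p y) ∧ l x = p x := by
  rcases eq_or_ne x 0 with rfl | hx
  · exact ⟨0, fun y => by simp, by simp⟩
  obtain ⟨g, hg, hgp⟩ := Module.Dual.exists_continuous_extension_of_le_seminorm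
    (Submodule.span ℝ {x}) (p x • (LinearEquiv.coord ℝ E x hx).toLinearMap) hp (fun y => by
      have hy := LinearEquiv.coord_apply_smul ℝ E x hx y
      conv_rhs => rw [← hy, map_smul_eq_mul]
      simp [abs_of_nonneg (apply_nonneg p x), mul_comm])
  refine ⟨g, hgp, ?_⟩
  have := hg ⟨x, Submodule.mem_span_singleton_self x⟩
  simpa [LinearEquiv.coord_self] using this

/-- A seminorm is determined by the functionals it dominates. -/
theorem Seminorm.le_of_forall_dual_le {E : Type*} [AddCommGroup E] [Module ℝ E]
    [TopologicalSpace E] [PolynormableSpace ℝ E] {p : Seminorm ℝ E} (hp : Continuous p) {x : E}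
    {C : ℝ} (h : ∀ l : StrongDual ℝ E, (∀ y, |l y| ≤ p y) → |l x| ≤ C) : p x ≤ C := by
  obtain ⟨l, hl, hlx⟩ := p.exists_dual_apply_eq hp x
  exact hlx ▸ (le_abs_self _).trans (h l hl)

theorem exists_continuous_seminorm_of_mem_nhds_zero {E : Type*} [AddCommGroup E] [Module ℝ E]
    [TopologicalSpace E] [PolynormableSpace ℝ E] {U : Set E} (hU : U ∈ 𝓝 (0 : E)) :
    ∃ p : Seminorm ℝ E, Continuous p ∧ ∀ x, p x < 1 → x ∈ U := by
  have hw := PolynormableSpace.withSeminorms ℝ E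
  have := hw.continuousSMul
  have := hw.topologicalAddGroup
  obtain ⟨s, r, hr, hs⟩ := (hw.mem_nhds_iff 0 U).1 hU
  let q : Seminorm ℝ E := s.sup fun p => p.1
  have hq : Continuous q := Seminorm.continuous' (r := 1) <| by
    rw [show q = s.sup fun p => p.1 from rfl,
      Seminorm.closedBall_finset_sup_eq_iInter _ _ _ zero_le_one]
    refine (Filter.biInter_finset_mem s).2 fun p _ => ?_
    filter_upwards [(p.2.tendsto 0).eventually (gt_mem_nhds (show p.1 0 < 1 by simp))] with y hy
    simpa using hy.le
  refine ⟨r⁻¹.toNNReal • q, ?_, fun x hx => hs ?_⟩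
  · exact (continuous_const.mul hq : Continuous fun x => (r⁻¹.toNNReal : ℝ) * q x)
  · have h1 : (r⁻¹.toNNReal : ℝ) * q x < 1 := hx
    rw [Real.coe_toNNReal _ (inv_nonneg.2 hr.le), inv_mul_lt_iff₀ hr, mul_one] at h1
    simpa using h1

/-! ### Partial derivatives along words -/

section Words

/-- If `∂^α` begins with `∂_i`, then what remains is `∂^β` with `β = α - e_i`. -/
theorem multiIndexWord_cases {d : ℕ} (α : Fin d → ℕ) :
    α = 0 ∨ ∃ (i : Fin d) (β : Fin d → ℕ),
      multiIndexWord α = i :: multiIndexWord β ∧ ∑ j, α j = ∑ j, β j + 1 := by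
  suffices h : ∀ L : List (Fin d), L.Nodup →
      (∀ i ∈ L, α i = 0) ∨ ∃ i ∈ L, α i ≠ 0 ∧
        L.flatMap (fun i => List.replicate (α i) i) =
          i :: L.flatMap (fun j => List.replicate (Function.update α i (α i - 1) j) j) by
    rcases h _ (List.nodup_finRange d) with h | ⟨i, -, hi, h⟩
    · exact Or.inl (funext fun i => h i (List.mem_finRange i))
    · refine Or.inr ⟨i, _, h, ?_⟩
      have h1 := Finset.add_sum_erase _ α (Finset.mem_univ i)
      have h2 := Finset.add_sum_erase _ (Function.update α i (α i - 1)) (Finset.mem_univ i)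
      have h3 : ∑ j ∈ Finset.univ.erase i, Function.update α i (α i - 1) j =
          ∑ j ∈ Finset.univ.erase i, α j :=
        Finset.sum_congr rfl fun j hj => Function.update_of_ne (Finset.ne_of_mem_erase hj) _ α
      rw [Function.update_self] at h2
      omega
  intro L
  induction L with
  | nil => simp
  | cons a L ih =>
    intro hL
    obtain ⟨haL, hL'⟩ := List.nodup_cons.1 hL
    by_cases ha : α a = 0
    · rcases ih hL' with h | ⟨i, hi, h0, h⟩
      · exact Or.inl (List.forall_mem_cons.2 ⟨ha, h⟩)
      · refine Or.inr ⟨i, List.mem_cons_of_mem _ hi, h0, ?_⟩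
        have hai : a ≠ i := fun h => haL (h ▸ hi)
        rw [List.flatMap_cons, List.flatMap_cons, h, Function.update_of_ne hai, ha]
        simp
    · refine Or.inr ⟨a, List.mem_cons_self, ha, ?_⟩
      obtain ⟨n, hn⟩ := Nat.exists_eq_succ_of_ne_zero ha
      have : L.flatMap (fun j => List.replicate (Function.update α a (α a - 1) j) j) =
          L.flatMap fun j => List.replicate (α j) j := by
        refine List.flatMap_congr fun j hj => ?_
        rw [Function.update_of_ne (fun h : j = a => haL (h ▸ hj))]
      rw [List.flatMap_cons, List.flatMap_cons, this, Function.update_self, hn,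
        List.replicate_succ]
      rfl

theorem multiIndexWord_zero {d : ℕ} : multiIndexWord (0 : Fin d → ℕ) = [] := by
  simp [multiIndexWord]

variable {d : ℕ} {F G : Type*} [AddCommGroup F] [Module ℝ F] [TopologicalSpace F]
  [AddCommGroup G] [Module ℝ G] [TopologicalSpace G]

theorem continuous_add_single (x : Fin d → ℝ) (i : Fin d) :
    Continuous fun t : ℝ => x + (Pi.single i t : Fin d → ℝ) :=
  continuous_const.add (continuous_const.update i continuous_id)

theorem eventually_add_single_mem {U : Set (Fin d → ℝ)} (hU : IsOpen U) {x : Fin d → ℝ}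
    (hx : x ∈ U) (i : Fin d) : ∀ᶠ t : ℝ in 𝓝 0, x + Pi.single i t ∈ U := by
  have := (continuous_add_single x i).tendsto 0
  simp only [Pi.single_zero, add_zero] at this
  exact this.eventually (hU.mem_nhds hx)

theorem HasPartialDerivAt.congr {U : Set (Fin d → ℝ)} (hU : IsOpen U) {i : Fin d}
    {f g : (Fin d → ℝ) → F} (hfg : Set.EqOn f g U) {y : F} {x : Fin d → ℝ} (hx : x ∈ U)
    (h : HasPartialDerivAt i f y x) : HasPartialDerivAt i g y x := by
  refine Tendsto.congr' ?_ h
  filter_upwards [(eventually_add_single_mem hU hx i).filter_mono nhdsWithin_le_nhds] with t ht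
  rw [hfg ht, hfg hx]

theorem HasIteratedPartialOn.congr {U : Set (Fin d → ℝ)} {w : List (Fin d)}
    {f f' g g' : (Fin d → ℝ) → F} (hf : Set.EqOn f f' U) (hg : Set.EqOn g g' U)
    (h : HasIteratedPartialOn U w f g) : HasIteratedPartialOn U w f' g' := by
  induction w generalizing g g' with
  | nil => exact hg.symm.trans (h.trans hf)
  | cons i w ih =>
    obtain ⟨k, hk, hkg⟩ := h
    exact ⟨k, ih (fun _ _ => rfl) hk, fun x hx => hg hx ▸ hkg x hx⟩

theorem HasPartialDerivAt.clm_comp (L : F →L[ℝ] G) {i : Fin d} {f : (Fin d → ℝ) → F} {y : F}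
    {x : Fin d → ℝ} (h : HasPartialDerivAt i f y x) :
    HasPartialDerivAt i (fun z => L (f z)) (L y) x := by
  refine ((L.continuous.tendsto y).comp h).congr fun t => ?_
  simp

theorem HasIteratedPartialOn.clm_comp (L : F →L[ℝ] G) {U : Set (Fin d → ℝ)} {w : List (Fin d)}
    {f g : (Fin d → ℝ) → F} (h : HasIteratedPartialOn U w f g) :
    HasIteratedPartialOn U w (fun z => L (f z)) (fun z => L (g z)) := by
  induction w generalizing g with
  | nil => exact fun x hx => congrArg L (h hx)
  | cons i w ih =>
    obtain ⟨k, hk, hkg⟩ := h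
    exact ⟨_, ih hk, fun x hx => (hkg x hx).clm_comp L⟩

theorem extend_val_clm_comp (L : F →L[ℝ] G) {R : Set (Fin d → ℝ)} (γ : R → F) :
    Function.extend Subtype.val (fun x => L (γ x)) 0 =
      fun z => L (Function.extend (Subtype.val : R → _) γ 0 z) := by
  ext z
  by_cases hz : ∃ a : R, a.1 = z
  · obtain ⟨a, rfl⟩ := hz
    simp only [Subtype.val_injective.extend_apply]
  · simp [Function.extend_apply' _ _ _ hz]

omit [Module ℝ F] [TopologicalSpace F] in
theorem extend_val_apply {R : Set (Fin d → ℝ)} (γ : R → F) {x : Fin d → ℝ} (hx : x ∈ R) :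
    Function.extend Subtype.val γ 0 x = γ ⟨x, hx⟩ :=
  Subtype.val_injective.extend_apply γ 0 ⟨x, hx⟩

theorem IsPartialExtension.clm_comp (L : F →L[ℝ] G) {R : Set (Fin d → ℝ)} {α : Fin d → ℕ}
    {γ g : C(R, F)} (h : IsPartialExtension α γ g) :
    IsPartialExtension α ((L : C(F, G)).comp γ) ((L : C(F, G)).comp g) := by
  have := HasIteratedPartialOn.clm_comp L h
  rw [← extend_val_clm_comp, ← extend_val_clm_comp] at this
  exact this

/-- Given an extension `g` of `∂^β γ`, the extensions of `∂_i ∂^β γ` are the continuous extensions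
of the `i`-th partial derivative of `g`. -/
theorem isPartialExtension_cons_iff [T2Space F] {R : Set (Fin d → ℝ)} {α β : Fin d → ℕ}
    {i : Fin d} (hα : multiIndexWord α = i :: multiIndexWord β) {γ g g' : C(R, F)}
    (hg : IsPartialExtension β γ g) :
    IsPartialExtension α γ g' ↔ ∀ x ∈ interior R,
      HasPartialDerivAt i (Function.extend Subtype.val g 0)
        (Function.extend Subtype.val g' 0 x) x := by
  rw [IsPartialExtension, hα]
  constructor
  · rintro ⟨h, hh, hg'⟩ x hx
    exact (hg' x hx).congr isOpen_interior (hh.eqOn isOpen_interior hg) hx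
  · exact fun h => ⟨_, hg, h⟩

theorem hasPartialDerivAt_iff_hasDerivAt {i : Fin d} {f : (Fin d → ℝ) → ℝ} {y : ℝ}
    {x : Fin d → ℝ} (s : ℝ) : HasPartialDerivAt i f y (x + Pi.single i s) ↔
      HasDerivAt (fun t => f (x + Pi.single i t)) y s := by
  rw [hasDerivAt_iff_tendsto_slope_zero, HasPartialDerivAt]
  simp only [Pi.single_add, add_assoc]

theorem hasPartialDerivAt_iff_hasDerivAt_zero {i : Fin d} {f : (Fin d → ℝ) → ℝ} {y : ℝ}
    {x : Fin d → ℝ} : HasPartialDerivAt i f y x ↔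
      HasDerivAt (fun t => f (x + Pi.single i t)) y 0 := by
  rw [← hasPartialDerivAt_iff_hasDerivAt, Pi.single_zero, add_zero]

/-- A continuous weak partial derivative is a partial derivative: by the mean value theorem,
applied to `l ∘ f` for the functionals `l` dominated by a continuous seminorm `p`, the error of the
difference quotient is bounded in `p` by the oscillation of `g`. -/
theorem hasPartialDerivAt_of_forall_dual [IsTopologicalAddGroup F] [ContinuousSMul ℝ F]
    [LocallyConvexSpace ℝ F] {U : Set (Fin d → ℝ)} (hU : IsOpen U)
    {i : Fin d} {f g : (Fin d → ℝ) → F} (hg : ContinuousOn g U)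
    (h : ∀ l : StrongDual ℝ F, ∀ x ∈ U, HasPartialDerivAt i (fun z => l (f z)) (l (g x)) x)
    {x : Fin d → ℝ} (hx : x ∈ U) : HasPartialDerivAt i f (g x) x := by
  rw [HasPartialDerivAt, (PolynormableSpace.withSeminorms ℝ F).tendsto_nhds]
  rintro ⟨p, hp⟩ ε hε
  have hev : ∀ᶠ t : ℝ in 𝓝 0, x + Pi.single i t ∈ U ∧ p (g (x + Pi.single i t) - g x) < ε / 2 := by
    refine (eventually_add_single_mem hU hx i).and ?_
    have h1 := (continuous_add_single x i).tendsto 0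
    simp only [Pi.single_zero, add_zero] at h1
    have h2 := (((hg.continuousAt (hU.mem_nhds hx)).tendsto.comp h1).sub_const (g x))
    rw [sub_self] at h2
    exact ((hp.tendsto 0).comp h2).eventually (gt_mem_nhds (by simpa using half_pos hε))
  obtain ⟨δ, hδ, hball⟩ := Metric.eventually_nhds_iff_ball.1 hev
  have hmem : ∀ᶠ t : ℝ in 𝓝[≠] 0, t ∈ Metric.ball (0 : ℝ) δ ∧ t ≠ 0 :=
    inter_mem (mem_nhdsWithin_of_mem_nhds (Metric.ball_mem_nhds (0 : ℝ) hδ)) self_mem_nhdsWithin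
  filter_upwards [hmem] with t ⟨ht, ht0⟩
  refine lt_of_le_of_lt (Seminorm.le_of_forall_dual_le hp (C := ε / 2) fun l hl => ?_)
    (half_lt_self hε)
  have hder : ∀ s ∈ Metric.ball (0 : ℝ) δ, HasDerivWithinAt
      (fun s => l (f (x + Pi.single i s)) - s * l (g x))
      (l (g (x + Pi.single i s)) - l (g x)) (Metric.ball (0 : ℝ) δ) s := fun s hs => by
    have h1 := (hasPartialDerivAt_iff_hasDerivAt s).1 (h l _ (hball s hs).1)
    have h2 := h1.sub ((hasDerivAt_id s).mul_const (l (g x)))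
    rw [one_mul] at h2
    exact h2.hasDerivWithinAt
  have hmv := (convex_ball (0 : ℝ) δ).norm_image_sub_le_of_norm_hasDerivWithin_le (C := ε / 2) hder
    (fun s hs => by
      rw [← map_sub]
      exact (hl _).trans (hball s hs).2.le) (Metric.mem_ball_self hδ) ht
  simp only [Pi.single_zero, add_zero, zero_mul, sub_zero, Real.norm_eq_abs] at hmv
  have ht' : 0 < |t| := abs_pos.2 ht0
  have key : l (t⁻¹ • (f (x + Pi.single i t) - f x) - g x) =
      t⁻¹ * (l (f (x + Pi.single i t)) - t * l (g x) - l (f x)) := by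
    simp only [map_sub, map_smul, smul_eq_mul]
    field_simp
    ring
  rw [key, abs_mul, abs_inv, inv_mul_le_iff₀ ht', mul_comm |t|]
  exact hmv

end Words

/-! ### Completeness of `C^ℓ(R, F)` -/

section Completeness

theorem ContinuousMap.isUniformAddGroup_of_uniformAddGroup {X F : Type*} [TopologicalSpace X]
    [AddCommGroup F] [UniformSpace F] [IsUniformAddGroup F] : IsUniformAddGroup C(X, F) :=
  IsUniformInducing.isUniformAddGroup
    (⟨⟨fun f => UniformOnFun.ofFun {K : Set X | IsCompact K} f, rfl⟩, fun _ _ => rfl⟩ :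
      C(X, F) →+ UniformOnFun X F {K : Set X | IsCompact K})
    ContinuousMap.isUniformEmbedding_toUniformOnFunIsCompact.isUniformInducing

variable {d : ℕ} {R : Set (Fin d → ℝ)} {hR : R ⊆ closure (interior R)} {ℓ : ℕ∞} {F : Type*}
  [AddCommGroup F] [Module ℝ F]

omit [Module ℝ F] in
theorem continuousOn_extend_val [TopologicalSpace F] (γ : C(R, F)) :
    ContinuousOn (Function.extend Subtype.val γ 0) R := by
  rw [continuousOn_iff_continuous_domRestrict]
  refine γ.continuous.congr fun x => ?_
  exact (extend_val_apply γ x.2).symm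

omit [Module ℝ F] in
theorem ContinuousMap.tendstoUniformlyOn_extend_val [UniformSpace F] {ι : Type*} {l : Filter ι}
    {u : ι → C(R, F)} {γ : C(R, F)} (h : Tendsto u l (𝓝 γ)) {K : Set (Fin d → ℝ)}
    (hK : IsCompact K) (hKR : K ⊆ R) :
    TendstoUniformlyOn (fun n => Function.extend Subtype.val (u n) 0)
      (Function.extend Subtype.val γ 0) l K := by
  have hK' : IsCompact (Subtype.val ⁻¹' K : Set R) :=
    Subtype.isCompact_iff.2 (by rwa [Subtype.image_preimage_coe, Set.inter_eq_right.2 hKR])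
  intro V hV
  filter_upwards [ContinuousMap.tendsto_iff_forall_isCompact_tendstoUniformlyOn.1 h _ hK' V hV]
    with n hn z hz
  rw [extend_val_apply _ (hKR hz), extend_val_apply _ (hKR hz)]
  exact hn ⟨z, hKR hz⟩ hz

/-- The limit of partial derivatives is the partial derivative of the limit. -/
theorem hasPartialDerivAt_of_tendsto [UniformSpace F] [IsUniformAddGroup F] [ContinuousSMul ℝ F]
    [LocallyConvexSpace ℝ F] [T2Space F]
    {ι : Type*} {l : Filter ι} [l.NeBot] {u v : ι → C(R, F)} {f g : C(R, F)}
    (hu : Tendsto u l (𝓝 f)) (hv : Tendsto v l (𝓝 g)) {i : Fin d}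
    (h : ∀ n, ∀ x ∈ interior R, HasPartialDerivAt i (Function.extend Subtype.val (u n) 0)
      (Function.extend Subtype.val (v n) 0 x) x) {x : Fin d → ℝ} (hx : x ∈ interior R) :
    HasPartialDerivAt i (Function.extend Subtype.val f 0)
      (Function.extend Subtype.val g 0 x) x := by
  refine hasPartialDerivAt_of_forall_dual isOpen_interior
    ((continuousOn_extend_val g).mono interior_subset) (fun L x hx => ?_) hx
  obtain ⟨r, hr, hball⟩ := Metric.eventually_nhds_iff_ball.1
    (eventually_add_single_mem isOpen_interior hx i)
  have hr2 : Metric.closedBall (0 : ℝ) (r / 2) ⊆ Metric.ball 0 r :=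
    Metric.closedBall_subset_ball (half_lt_self hr)
  set K := (fun t : ℝ => x + (Pi.single i t : Fin d → ℝ)) '' Metric.closedBall 0 (r / 2) with hK
  have hKc : IsCompact K := (isCompact_closedBall _ _).image (continuous_add_single x i)
  have hKR : K ⊆ R := by
    rintro _ ⟨t, ht, rfl⟩
    exact interior_subset (hball t (hr2 ht))
  have hL : UniformContinuous L := L.uniformContinuous
  have hmem : ∀ t ∈ Metric.ball (0 : ℝ) (r / 2), x + Pi.single i t ∈ K := fun t ht =>
    ⟨t, Metric.ball_subset_closedBall ht, rfl⟩
  rw [hasPartialDerivAt_iff_hasDerivAt_zero]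
  have hg : TendstoUniformlyOn
      (fun n t => L (Function.extend Subtype.val (v n) 0 (x + Pi.single i t)))
      (fun t => L (Function.extend Subtype.val g 0 (x + Pi.single i t))) l
      (Metric.ball (0 : ℝ) (r / 2)) := by
    have h1 := hL.comp_tendstoUniformlyOn
      (ContinuousMap.tendstoUniformlyOn_extend_val hv hKc hKR)
    intro V hV
    filter_upwards [h1 V hV] with n hn t ht using hn _ (hmem t ht)
  have hf : ∀ t ∈ Metric.ball (0 : ℝ) (r / 2), Tendsto
      (fun n => L (Function.extend Subtype.val (u n) 0 (x + Pi.single i t))) l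
      (𝓝 (L (Function.extend Subtype.val f 0 (x + Pi.single i t)))) := fun t ht =>
    (L.continuous.tendsto _).comp
      ((ContinuousMap.tendstoUniformlyOn_extend_val hu hKc hKR).tendsto_at (hmem t ht))
  have hd : ∀ n, ∀ t ∈ Metric.ball (0 : ℝ) (r / 2), HasDerivAt
      (fun t => L (Function.extend Subtype.val (u n) 0 (x + Pi.single i t)))
      (L (Function.extend Subtype.val (v n) 0 (x + Pi.single i t))) t := fun n t ht =>
    (hasPartialDerivAt_iff_hasDerivAt t).1
      ((h n _ (hball t (hr2 (Metric.ball_subset_closedBall ht)))).clm_comp L)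
  have := hasDerivAt_of_tendstoUniformlyOn Metric.isOpen_ball hg (Eventually.of_forall hd) hf
    (Metric.mem_ball_self (half_pos hr))
  simpa only [Pi.single_zero, add_zero] using this

namespace CEll

variable [UniformSpace F] [IsUniformAddGroup F] [ContinuousSMul ℝ F] [T2Space F]

/-- The linear map `γ ↦ (∂^α γ)_α`, into the product of copies of `C(R, F)` indexed by the
`α` with `|α| ≤ ℓ`. -/
def jet : CEll R ℓ F hR →ₗ[ℝ] {α : Fin d → ℕ // ((∑ i, α i : ℕ) : ℕ∞) ≤ ℓ} → C(R, F) :=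
  LinearMap.pi partialLM

theorem isInducing_jet : IsInducing (jet : CEll R ℓ F hR →ₗ[ℝ] _) :=
  inducing_iInf_to_pi fun (α : {α : Fin d → ℕ // ((∑ i, α i : ℕ) : ℕ∞) ≤ ℓ})
    (γ : CEll R ℓ F hR) => partialLM α γ

theorem partialLM_zero (γ : CEll R ℓ F hR) : partialLM ⟨0, by simp⟩ γ = γ.1 := by
  refine (partialFun_spec _ γ).unique hR ?_
  rw [IsPartialExtension, multiIndexWord_zero]
  exact fun _ _ => rfl

theorem jet_injective : Function.Injective (jet : CEll R ℓ F hR →ₗ[ℝ] _) := fun γ η h => by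
  have := congrFun h ⟨0, by simp⟩
  refine Subtype.ext ?_
  rw [← partialLM_zero, ← partialLM_zero]
  exact this

instance : T2Space (CEll R ℓ F hR) :=
  (IsEmbedding.mk isInducing_jet jet_injective).t2Space

/-- By induction on `|α|`: if `G` is a limit of jets `(∂^α γ)_α`, then `G α` extends
`∂^α (G 0)`. -/
theorem isClosed_range_jet [LocallyConvexSpace ℝ F] :
    IsClosed (Set.range (jet : CEll R ℓ F hR →ₗ[ℝ] _)) := by
  refine isClosed_of_closure_subset fun G hG => ?_
  set l := comap (jet : CEll R ℓ F hR →ₗ[ℝ] _) (𝓝 G)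
  have : l.NeBot := comap_neBot_iff.2 fun s hs => by
    obtain ⟨_, h1, γ, rfl⟩ := mem_closure_iff_nhds.1 hG s hs
    exact ⟨γ, h1⟩
  have hl : ∀ α, Tendsto (partialLM α : CEll R ℓ F hR →ₗ[ℝ] _) l (𝓝 (G α)) := fun α =>
    ((continuous_apply α).tendsto G).comp tendsto_comap
  have key : ∀ n (α : {α : Fin d → ℕ // ((∑ i, α i : ℕ) : ℕ∞) ≤ ℓ}), ∑ i, α.1 i = n →
      IsPartialExtension α.1 (G ⟨0, by simp⟩) (G α) := by
    intro n
    induction n with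
    | zero =>
      rintro ⟨α, hα⟩ h0
      obtain rfl : α = 0 := by
        funext i
        simpa using (Finset.sum_eq_zero_iff.1 h0) i (Finset.mem_univ i)
      rw [IsPartialExtension, multiIndexWord_zero]
      exact fun _ _ => rfl
    | succ n ih =>
      rintro ⟨α, hα⟩ hn
      rcases multiIndexWord_cases α with rfl | ⟨i, β, hw, hsum⟩
      · simp at hn
      have hβ : ((∑ j, β j : ℕ) : ℕ∞) ≤ ℓ := by
        refine le_trans ?_ hα
        exact_mod_cast (show ∑ j, β j ≤ ∑ j, α j by omega)
      refine (isPartialExtension_cons_iff hw (ih ⟨β, hβ⟩ (by simp only at hn ⊢; omega))).2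
        fun x hx => ?_
      refine hasPartialDerivAt_of_tendsto (hl ⟨β, hβ⟩) (hl ⟨α, hα⟩) (fun γ => ?_) hx
      exact (isPartialExtension_cons_iff hw (partialFun_spec ⟨β, hβ⟩ γ)).1
        (partialFun_spec ⟨α, hα⟩ γ)
  let γ : CEll R ℓ F hR := ⟨G ⟨0, by simp⟩, fun α hα => ⟨G ⟨α, hα⟩, key _ ⟨α, hα⟩ rfl⟩⟩
  refine ⟨γ, funext fun α => ?_⟩
  exact (partialFun_spec α γ).unique hR (key _ α rfl)

theorem completeSpace [LocallyConvexSpace ℝ F] [CompleteSpace F] :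
    letI := IsTopologicalAddGroup.rightUniformSpace (CEll R ℓ F hR)
    CompleteSpace (CEll R ℓ F hR) := by
  let := IsTopologicalAddGroup.rightUniformSpace (CEll R ℓ F hR)
  have : IsUniformAddGroup (CEll R ℓ F hR) := isUniformAddGroup_of_addCommGroup
  have : IsUniformAddGroup C(R, F) := ContinuousMap.isUniformAddGroup_of_uniformAddGroup
  have hJ : IsUniformInducing (jet : CEll R ℓ F hR →ₗ[ℝ] _) :=
    AddMonoidHom.isUniformInducing_of_isInducing isInducing_jet
  exact hJ.completeSpace isClosed_range_jet.isComplete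

end CEll

end Completeness

/-! ### The `ε`-topology on `F ⊗ C^ℓ(R, ℝ)` -/

section EpsTopology

theorem ContinuousMap.tendsto_nhds_zero_iff {X Y ι : Type*} [TopologicalSpace X]
    [TopologicalSpace Y] [Zero Y] {l : Filter ι} {u : ι → C(X, Y)} :
    Tendsto u l (𝓝 0) ↔ ∀ K : Set X, IsCompact K → ∀ U ∈ 𝓝 (0 : Y),
      ∀ᶠ n in l, Set.MapsTo (u n) K U := by
  rw [ContinuousMap.tendsto_nhds_compactOpen]
  constructor
  · intro h K hK U hU
    obtain ⟨V, hVU, hV, h0⟩ := mem_nhds_iff.1 hU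
    exact (h K hK V hV fun _ _ => h0).mono fun n hn => hn.mono_right hVU
  · intro h K hK U hU h0
    rcases K.eq_empty_or_nonempty with rfl | ⟨x, hx⟩
    · exact Eventually.of_forall fun n => Set.mapsTo_empty _ _
    · exact h K hK U (hU.mem_nhds (h0 hx))

/-- A point of `E'_τ`, as a continuous linear functional on `E`. -/
def MackeyDual.toStrongDual {E : Type*} [AddCommGroup E] [Module ℝ E] [TopologicalSpace E] :
    MackeyDual E ≃ StrongDual ℝ E :=
  (UniformConvergenceCLM.ofFun (RingHom.id ℝ) ℝ _).symm

namespace CEll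

variable {d : ℕ} {R : Set (Fin d → ℝ)} {hR : R ⊆ closure (interior R)} {ℓ : ℕ∞} {F G : Type*}
  [AddCommGroup F] [Module ℝ F] [TopologicalSpace F] [IsTopologicalAddGroup F] [ContinuousSMul ℝ F]
  [AddCommGroup G] [Module ℝ G] [TopologicalSpace G] [IsTopologicalAddGroup G] [ContinuousSMul ℝ G]

theorem tendsto_nhds_zero_iff [T2Space F] {ι : Type*} {l : Filter ι} {u : ι → CEll R ℓ F hR} :
    Tendsto u l (𝓝 0) ↔ ∀ (α : {α : Fin d → ℕ // ((∑ i, α i : ℕ) : ℕ∞) ≤ ℓ}) (K : Set R),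
      IsCompact K → ∀ U ∈ 𝓝 (0 : F), ∀ᶠ n in l, Set.MapsTo (partialLM α (u n)) K U := by
  simp only [nhds_iInf, nhds_induced, tendsto_iInf, tendsto_comap_iff, map_zero]
  exact forall_congr' fun α => ContinuousMap.tendsto_nhds_zero_iff

/-- Composition with a continuous linear map `L : F → G`, as a map `C^ℓ(R, F) → C^ℓ(R, G)`. -/
def postcomp (L : F →L[ℝ] G) : CEll R ℓ F hR →ₗ[ℝ] CEll R ℓ G hR where
  toFun γ := ⟨(L : C(F, G)).comp γ.1, fun α hα => ⟨_, (partialFun_spec ⟨α, hα⟩ γ).clm_comp L⟩⟩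
  map_add' γ η := DFunLike.ext _ _ fun x => L.map_add (γ x) (η x)
  map_smul' c γ := DFunLike.ext _ _ fun x => L.map_smul c (γ x)

theorem postcomp_apply (L : F →L[ℝ] G) (γ : CEll R ℓ F hR) (x : R) :
    postcomp L γ x = L (γ x) := rfl

theorem partialLM_postcomp [T2Space F] [T2Space G] (L : F →L[ℝ] G)
    (α : {α : Fin d → ℕ // ((∑ i, α i : ℕ) : ℕ∞) ≤ ℓ}) (γ : CEll R ℓ F hR) (x : R) :
    partialLM α (postcomp L γ) x = L (partialLM α γ x) := by
  have := (partialFun_spec α (postcomp L γ)).unique hR ((partialFun_spec α γ).clm_comp L)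
  exact DFunLike.congr_fun this x

/-- The linear map `F ⊗ C^ℓ(R, ℝ) → C^ℓ(R, F)` which takes `v ⊗ γ` to `x ↦ γ(x) v`. -/
def ofTensor : F ⊗[ℝ] CEll R ℓ ℝ hR →ₗ[ℝ] CEll R ℓ F hR :=
  TensorProduct.lift <| LinearMap.mk₂ ℝ
    (fun v γ => postcomp (ContinuousLinearMap.toSpanSingleton ℝ v) γ)
    (fun v w γ => DFunLike.ext _ _ fun x => smul_add (γ x) v w)
    (fun c v γ => DFunLike.ext _ _ fun x => smul_comm (γ x) c v)
    (fun _ γ η => map_add _ γ η)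
    (fun c _ γ => map_smul _ c γ)

theorem ofTensor_tmul (v : F) (γ : CEll R ℓ ℝ hR) :
    ofTensor (v ⊗ₜ[ℝ] γ) = postcomp (ContinuousLinearMap.toSpanSingleton ℝ v) γ := rfl

/-- Under the identification of tensors with functions, `ψ z` is `l ↦ l ∘ z`. -/
theorem epsMap_apply_eq_postcomp (z : F ⊗[ℝ] CEll R ℓ ℝ hR) (l : MackeyDual F) :
    epsMap F (CEll R ℓ ℝ hR) z l = postcomp l.toStrongDual (ofTensor z) := by
  induction z with
  | zero => simp
  | add z z' hz hz' => rw [map_add, map_add, map_add, ← hz, ← hz']; rfl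
  | tmul v γ =>
    refine DFunLike.ext _ _ fun x => ?_
    rw [ofTensor_tmul, postcomp_apply, postcomp_apply]
    exact ((l.toStrongDual.map_smul (γ x) v).trans (mul_comm _ _)).symm

/-- The `ε`-topology on `F ⊗ C^ℓ(R, ℝ)` is induced by the topology of `C^ℓ(R, F)`. In one direction,
the functionals dominated by a continuous seminorm are an equicontinuous set, and they determine the
seminorm. In the other direction, the functionals in an equicontinuous set are uniformly small on a
neighbourhood of `0`. -/
theorem comap_epsMap_nhds_zero [T2Space F] [LocallyConvexSpace ℝ F] :
    comap (epsMap F (CEll R ℓ ℝ hR)) (𝓝 0) =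
      comap (ofTensor : F ⊗[ℝ] CEll R ℓ ℝ hR →ₗ[ℝ] CEll R ℓ F hR) (𝓝 0) := by
  apply le_antisymm
  · rw [← tendsto_iff_comap, tendsto_nhds_zero_iff]
    intro α K hK U hU
    obtain ⟨p, hp, hpU⟩ := exists_continuous_seminorm_of_mem_nhds_zero hU
    let S : Set (MackeyDual F) := {l | ∀ y, |l.toStrongDual y| ≤ p y}
    have hS : S ∈ equicontinuousSets F := by
      refine fun x₀ => Metric.equicontinuousAt_of_continuity_modulus (fun x => p (x₀ - x)) ?_ _
        (Eventually.of_forall fun x l => ?_)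
      · have : Continuous fun x => p (x₀ - x) := hp.comp (continuous_const.sub continuous_id)
        simpa using this.tendsto x₀
      · rw [Real.dist_eq]
        have := l.2 (x₀ - x)
        rwa [map_sub] at this
    let V : Set (CEll R ℓ ℝ hR) := {γ | Set.MapsTo (partialLM α γ) K (Metric.ball 0 (1 / 2))}
    have hV : V ∈ 𝓝 (0 : CEll R ℓ ℝ hR) :=
      tendsto_nhds_zero_iff.1 tendsto_id α K hK _ (Metric.ball_mem_nhds _ (by norm_num))
    have hW : {T : EpsHom F (CEll R ℓ ℝ hR) | Set.MapsTo T S V} ∈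
        𝓝 (0 : EpsHom F (CEll R ℓ ℝ hR)) := by
      rw [UniformConvergenceCLM.nhds_zero_eq]
      exact mem_iInf_of_mem S (mem_iInf_of_mem hS (mem_iInf_of_mem V
        (mem_iInf_of_mem hV (mem_principal_self _))))
    filter_upwards [preimage_mem_comap hW] with z hz x hx
    refine hpU _ (lt_of_le_of_lt (Seminorm.le_of_forall_dual_le hp (C := 1 / 2) fun l hl => ?_)
      (by norm_num))
    have h1 := hz (show MackeyDual.toStrongDual.symm l ∈ S from hl) hx
    rw [epsMap_apply_eq_postcomp, partialLM_postcomp] at h1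
    rw [Equiv.apply_symm_apply, mem_ball_zero_iff] at h1
    exact h1.le
  · rw [← tendsto_iff_comap, UniformConvergenceCLM.nhds_zero_eq]
    simp only [tendsto_iInf, tendsto_principal]
    intro S hS V hV
    suffices h : Tendsto (fun q : (F ⊗[ℝ] CEll R ℓ ℝ hR) × MackeyDual F =>
        epsMap F (CEll R ℓ ℝ hR) q.1 q.2)
        (comap (ofTensor : F ⊗[ℝ] CEll R ℓ ℝ hR →ₗ[ℝ] CEll R ℓ F hR) (𝓝 0) ×ˢ 𝓟 S)
        (𝓝 0) from eventually_prod_principal_iff.1 (h hV)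
    rw [tendsto_nhds_zero_iff]
    intro α K hK U hU
    obtain ⟨ε, hε, hεU⟩ := Metric.mem_nhds_iff.1 hU
    have hW : {y : F | ∀ l ∈ S, |l.toStrongDual y| < ε} ∈ 𝓝 (0 : F) := by
      filter_upwards [Metric.equicontinuousAt_iff_right.1 (hS 0) ε hε] with y hy l hl
      have h1 := hy ⟨l, hl⟩
      rw [Real.dist_eq, map_zero, zero_sub, abs_neg] at h1
      exact h1
    rw [eventually_prod_principal_iff]
    filter_upwards [tendsto_nhds_zero_iff.1 tendsto_comap α K hK _ hW] with z hz l hl x hx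
    refine hεU ?_
    rw [epsMap_apply_eq_postcomp, partialLM_postcomp]
    simpa using hz hx l hl

/-- `ofTensor`, as a map on `F ⊗_ε C^ℓ(R, ℝ)`. -/
def ofEpsTensor : EpsTensor F (CEll R ℓ ℝ hR) →ₗ[ℝ] CEll R ℓ F hR := ofTensor

theorem isInducing_ofEpsTensor [T2Space F] [LocallyConvexSpace ℝ F] :
    IsInducing (ofEpsTensor : EpsTensor F (CEll R ℓ ℝ hR) →ₗ[ℝ] CEll R ℓ F hR) := by
  refine isInducing_iff_nhds.2 fun z => ?_
  have h0 : 𝓝 (0 : EpsTensor F (CEll R ℓ ℝ hR)) =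
      comap (ofEpsTensor : EpsTensor F (CEll R ℓ ℝ hR) →ₗ[ℝ] CEll R ℓ F hR) (𝓝 0) := by
    refine Eq.trans ?_ comap_epsMap_nhds_zero
    rw [← map_zero (epsMap F (CEll R ℓ ℝ hR))]
    exact nhds_induced _ _
  rw [← nhds_translation_sub z, h0, ← nhds_translation_sub (ofEpsTensor z), comap_comap,
    comap_comap]
  congr 1
  ext y
  exact map_sub _ y z

end CEll
end EpsTopology

/-! ### Mollification along coordinate words -/

section Mollification

open MeasureTheory
open scoped ContDiff Convolution

variable {d : ℕ}

/-- The iterated partial derivative `∂_{i₁} (∂_{i₂} (⋯ (∂_{i_k} φ)))` of a smooth function along the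
word `i₁ i₂ … i_k`, as in `HasIteratedPartialOn`. -/
def wordDeriv : List (Fin d) → ((Fin d → ℝ) → ℝ) → (Fin d → ℝ) → ℝ
  | [], φ => φ
  | i :: w, φ => fun x => fderiv ℝ (wordDeriv w φ) x (Pi.single i 1)

theorem ContDiff.wordDeriv {φ : (Fin d → ℝ) → ℝ} (hφ : ContDiff ℝ ∞ φ) (w : List (Fin d)) :
    ContDiff ℝ ∞ (wordDeriv w φ) := by
  induction w with
  | nil => exact hφ
  | cons i w ih => exact (ih.fderiv_right (m := ∞) (by simp)).clm_apply contDiff_const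

theorem HasCompactSupport.wordDeriv {φ : (Fin d → ℝ) → ℝ} (hφ : HasCompactSupport φ)
    (w : List (Fin d)) : HasCompactSupport (wordDeriv w φ) := by
  induction w with
  | nil => exact hφ
  | cons i w ih => exact ih.fderiv_apply ℝ _

theorem HasFDerivAt.hasPartialDerivAt {f : (Fin d → ℝ) → ℝ} {f' : (Fin d → ℝ) →L[ℝ] ℝ}
    {x : Fin d → ℝ} (h : HasFDerivAt f f' x) (i : Fin d) :
    HasPartialDerivAt i f (f' (Pi.single i 1)) x := by
  have h1 : HasDerivAt (fun t : ℝ => x + t • (Pi.single i 1 : Fin d → ℝ)) (Pi.single i 1) 0 := by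
    simpa using ((hasDerivAt_id (0 : ℝ)).smul_const (Pi.single i 1 : Fin d → ℝ)).const_add x
  have h2 : HasFDerivAt f f' (x + (0 : ℝ) • (Pi.single i 1 : Fin d → ℝ)) := by simpa using h
  rw [hasPartialDerivAt_iff_hasDerivAt_zero]
  refine (h2.comp_hasDerivAt 0 h1).congr_of_eventuallyEq (Eventually.of_forall fun t => ?_)
  simp [← Pi.single_smul]

theorem ContDiff.hasIteratedPartialOn {φ : (Fin d → ℝ) → ℝ} (hφ : ContDiff ℝ ∞ φ)
    (U : Set (Fin d → ℝ)) (w : List (Fin d)) :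
    HasIteratedPartialOn U w φ (_root_.wordDeriv w φ) := by
  induction w with
  | nil => exact fun _ _ => rfl
  | cons i w ih =>
    exact ⟨_, ih, fun x _ =>
      ((hφ.wordDeriv w).differentiable (by simp) x).hasFDerivAt.hasPartialDerivAt i⟩

/-- The convolution of two real functions on `ℝ^d`. -/
abbrev realConv (φ g : (Fin d → ℝ) → ℝ) : (Fin d → ℝ) → ℝ :=
  φ ⋆[ContinuousLinearMap.lsmul ℝ ℝ, volume] g

theorem realConv_apply (φ g : (Fin d → ℝ) → ℝ) (x : Fin d → ℝ) :
    realConv φ g x = ∫ y, φ y * g (x - y) := rfl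

theorem integrable_mul_sub {φ g : (Fin d → ℝ) → ℝ} (hφ : Continuous φ) (hc : HasCompactSupport φ)
    (hg : LocallyIntegrable g volume) (x : Fin d → ℝ) :
    Integrable (fun y => φ y * g (x - y)) volume :=
  hc.convolutionExists_left (ContinuousLinearMap.lsmul ℝ ℝ) hφ hg x

theorem ContDiff.realConv {φ g : (Fin d → ℝ) → ℝ} (hφ : ContDiff ℝ ∞ φ)
    (hc : HasCompactSupport φ) (hg : LocallyIntegrable g volume) :
    ContDiff ℝ ∞ (realConv φ g) :=
  hc.contDiff_convolution_left _ hφ hg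

theorem wordDeriv_realConv {φ g : (Fin d → ℝ) → ℝ} (hφ : ContDiff ℝ ∞ φ)
    (hc : HasCompactSupport φ) (hg : LocallyIntegrable g volume) (w : List (Fin d)) :
    wordDeriv w (realConv φ g) = realConv (wordDeriv w φ) g := by
  induction w with
  | nil => rfl
  | cons i w ih =>
    ext x
    have hψ := hφ.wordDeriv w
    have h := HasCompactSupport.hasFDerivAt_convolution_left (ContinuousLinearMap.lsmul ℝ ℝ)
      (hc.wordDeriv w) (hψ.of_le (by simp)) hg x
    have h1 : ConvolutionExistsAt (fderiv ℝ (wordDeriv w φ)) g x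
        ((ContinuousLinearMap.lsmul ℝ ℝ).precompL (Fin d → ℝ)) volume :=
      ((hc.wordDeriv w).fderiv ℝ).convolutionExists_left _ (hψ.continuous_fderiv (by simp)) hg x
    change fderiv ℝ (wordDeriv w (realConv φ g)) x (Pi.single i 1) = _
    rw [ih, h.fderiv, convolution_def, ContinuousLinearMap.integral_apply h1]
    rfl

/-- Convolution with `φ` commutes with partial derivatives of functions which are only `C^1` near
the support of `y ↦ φ (x - y)`. -/
theorem hasPartialDerivAt_realConv {φ u v : (Fin d → ℝ) → ℝ} {V : Set (Fin d → ℝ)} {δ r : ℝ}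
    (hφ : Continuous φ) (hsupp : ∀ y ∉ Metric.closedBall (0 : Fin d → ℝ) δ, φ y = 0)
    (hu : ContinuousOn u V) (hv : ContinuousOn v V) {i : Fin d}
    (huv : ∀ z ∈ V, HasPartialDerivAt i u (v z) z) (hr : δ < r) {x : Fin d → ℝ}
    (hx : Metric.closedBall x r ⊆ V) :
    HasPartialDerivAt i (realConv φ u) (realConv φ v x) x := by
  set B := Metric.closedBall (0 : Fin d → ℝ) δ with hB
  have hBc : IsCompact B := isCompact_closedBall _ _
  have hset : ∀ (g : (Fin d → ℝ) → ℝ) z, realConv φ g z = ∫ y in B, φ y * g (z - y) := by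
    intro g z
    rw [realConv_apply, setIntegral_eq_integral_of_forall_compl_eq_zero]
    intro y hy
    rw [hsupp y hy, zero_mul]
  have hmem : ∀ t ∈ Metric.ball (0 : ℝ) (r - δ), ∀ y ∈ B,
      x + Pi.single i t - y ∈ Metric.closedBall x r := by
    intro t ht y hy
    rw [mem_ball_zero_iff] at ht
    rw [hB, mem_closedBall_zero_iff] at hy
    rw [mem_closedBall_iff_norm, add_sub_assoc, add_sub_cancel_left]
    refine (norm_sub_le _ _).trans ?_
    rw [Pi.norm_single]
    linarith
  have hcont : ∀ g : (Fin d → ℝ) → ℝ, ContinuousOn g V → ∀ t ∈ Metric.ball (0 : ℝ) (r - δ),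
      ContinuousOn (fun y => φ y * g (x + Pi.single i t - y)) B := by
    intro g hg t ht
    refine hφ.continuousOn.mul (hg.comp (continuous_const.sub continuous_id).continuousOn ?_)
    exact fun y hy => hx (hmem t ht y hy)
  have h0 : (0 : ℝ) ∈ Metric.ball (0 : ℝ) (r - δ) := Metric.mem_ball_self (sub_pos.2 hr)
  obtain ⟨M, hM⟩ := (isCompact_closedBall x r).exists_bound_of_continuousOn (hv.mono hx)
  obtain ⟨C, hC⟩ := hBc.exists_bound_of_continuousOn hφ.continuousOn
  have hs : Metric.ball (0 : ℝ) (r - δ) ∈ 𝓝 (0 : ℝ) := Metric.ball_mem_nhds _ (sub_pos.2 hr)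
  have key := hasDerivAt_integral_of_dominated_loc_of_deriv_le (μ := volume.restrict B)
    (F := fun t y => φ y * u (x + Pi.single i t - y))
    (F' := fun t y => φ y * v (x + Pi.single i t - y)) (bound := fun _ => C * M) hs
    (by
      filter_upwards [hs] with t ht
      exact (hcont u hu t ht).aestronglyMeasurable hBc.measurableSet)
    ((hcont u hu 0 h0).integrableOn_compact hBc)
    ((hcont v hv 0 h0).aestronglyMeasurable hBc.measurableSet)
    (by
      filter_upwards [ae_restrict_mem hBc.measurableSet] with y hy t ht
      rw [norm_mul]
      exact mul_le_mul (hC y hy) (hM _ (hmem t ht y hy)) (norm_nonneg _)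
        ((norm_nonneg _).trans (hC y hy)))
    (integrableOn_const hBc.measure_lt_top.ne)
    (by
      filter_upwards [ae_restrict_mem hBc.measurableSet] with y hy t ht
      have h1 : x + Pi.single i t - y = x - y + Pi.single i t := by abel
      have h2 := huv _ (hx (hmem t ht y hy))
      rw [h1, hasPartialDerivAt_iff_hasDerivAt] at h2
      refine HasDerivAt.const_mul (φ y) ?_
      rw [h1]
      refine h2.congr_of_eventuallyEq (Eventually.of_forall fun s => ?_)
      simp only [add_sub_right_comm])
  rw [hasPartialDerivAt_iff_hasDerivAt_zero]
  simp only [hset]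
  simpa using key.2

end Mollification

/-! ### Approximation by finite sums of smooth functions times vectors -/

section Approximation

open MeasureTheory
open scoped ContDiff Convolution

variable {d : ℕ}

/-- Integration by parts: if `u β`, for `|β| ≤ ℓ`, are the partial derivatives of `u 0` on the open
set `V`, then `(∂^α φ) ⋆ u 0 = φ ⋆ u α` at the points whose `δ`-neighbourhood lies well inside `V`.
Both sides are `∂^α (φ ⋆ u 0)`. The functions are cut off outside of a compact set `K` to make them
integrable. -/
theorem realConv_wordDeriv_eq {ℓ : ℕ∞} {u : (Fin d → ℕ) → (Fin d → ℝ) → ℝ}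
    {V K W : Set (Fin d → ℝ)} (hV : IsOpen V) (hK : IsCompact K) (hVK : V ⊆ K) (hW : IsOpen W)
    (hu : ∀ β, ((∑ j, β j : ℕ) : ℕ∞) ≤ ℓ → ContinuousOn (u β) K)
    (hd : ∀ (α β : Fin d → ℕ) (i : Fin d), ((∑ j, α j : ℕ) : ℕ∞) ≤ ℓ →
      multiIndexWord α = i :: multiIndexWord β → ∑ j, α j = ∑ j, β j + 1 → ∀ z ∈ V,
        HasPartialDerivAt i (u β) (u α z) z)
    {φ : (Fin d → ℝ) → ℝ} (hφ : ContDiff ℝ ∞ φ) (hc : HasCompactSupport φ) {δ r : ℝ}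
    (hsupp : ∀ y ∉ Metric.closedBall (0 : Fin d → ℝ) δ, φ y = 0) (hr : δ < r)
    (hWV : ∀ x ∈ W, Metric.closedBall x r ⊆ V) {α : Fin d → ℕ} (hα : ((∑ j, α j : ℕ) : ℕ∞) ≤ ℓ) :
    Set.EqOn (realConv (wordDeriv (multiIndexWord α) φ) (K.indicator (u 0)))
      (realConv φ (K.indicator (u α))) W := by
  have hint : ∀ β, ((∑ j, β j : ℕ) : ℕ∞) ≤ ℓ → LocallyIntegrable (K.indicator (u β)) volume :=
    fun β hβ => (((hu β hβ).integrableOn_compact hK).integrable_indicator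
      hK.measurableSet).locallyIntegrable
  have hcont : ∀ β, ((∑ j, β j : ℕ) : ℕ∞) ≤ ℓ → ContinuousOn (K.indicator (u β)) V :=
    fun β hβ => ((hu β hβ).mono hVK).congr fun z hz => Set.indicator_of_mem (hVK hz) _
  have key : ∀ n (α : Fin d → ℕ), ((∑ j, α j : ℕ) : ℕ∞) ≤ ℓ → ∑ j, α j = n →
      HasIteratedPartialOn W (multiIndexWord α) (realConv φ (K.indicator (u 0)))
        (realConv φ (K.indicator (u α))) := by
    intro n
    induction n with
    | zero =>
      intro α _ h0
      obtain rfl : α = 0 := by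
        funext i
        simpa using (Finset.sum_eq_zero_iff.1 h0) i (Finset.mem_univ i)
      rw [multiIndexWord_zero]
      exact fun _ _ => rfl
    | succ n ih =>
      intro α hα hn
      rcases multiIndexWord_cases α with rfl | ⟨i, β, hw, hsum⟩
      · simp at hn
      have hβ : ((∑ j, β j : ℕ) : ℕ∞) ≤ ℓ := by
        refine le_trans ?_ hα
        exact_mod_cast (show ∑ j, β j ≤ ∑ j, α j by omega)
      rw [hw]
      refine ⟨_, ih β hβ (by omega), fun x hx => ?_⟩
      refine hasPartialDerivAt_realConv hφ.continuous hsupp (hcont β hβ) (hcont α hα)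
        (fun z hz => ?_) hr (hWV x hx)
      rw [Set.indicator_of_mem (hVK hz)]
      exact (hd α β i hα hw hsum z hz).congr hV
        (fun y hy => (Set.indicator_of_mem (hVK hy) _).symm) hz
  have h0 := (hφ.realConv hc (hint 0 (by simp))).hasIteratedPartialOn W (multiIndexWord α)
  rw [wordDeriv_realConv hφ hc (hint 0 (by simp))] at h0
  exact h0.eqOn hW (key _ α hα rfl)

/-- A vector-valued continuous function on a compact set is uniformly approximated by finite sums
of compactly supported continuous functions times vectors, namely `∑ j, χ j • u (y j)` for a
partition of unity `χ` subordinate to a cover by neighbourhoods of points `y j` on which `u` is almost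
constant. -/
theorem exists_partition_approx {X F : Type*} [TopologicalSpace X] [T2Space X]
    [LocallyCompactSpace X] [AddCommGroup F] [Module ℝ F] [TopologicalSpace F]
    [IsTopologicalAddGroup F]
    {p : Seminorm ℝ F} (hp : Continuous p) {U K : Set X} (hU : IsOpen U) (hK : IsCompact K)
    (hKU : K ⊆ U) {u : X → F} (hu : ContinuousOn u U) {ε : ℝ} (hε : 0 < ε) :
    ∃ (n : ℕ) (χ : Fin n → C(X, ℝ)) (c : Fin n → F), (∀ j, HasCompactSupport (χ j)) ∧
      ∀ y ∈ K, p (∑ j, χ j y • c j - u y) ≤ ε := by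
  have hO : ∀ y, IsOpen (U ∩ u ⁻¹' {z | p (u y - z) < ε}) := fun y =>
    hu.isOpen_inter_preimage hU
      (isOpen_lt (hp.comp (continuous_const.sub continuous_id)) continuous_const)
  obtain ⟨t, ht, hcov⟩ := hK.elim_nhds_subcover (fun y => U ∩ u ⁻¹' {z | p (u y - z) < ε})
    fun y hy => (hO y).mem_nhds ⟨hKU hy, by simpa using hε⟩
  let e := t.equivFin.symm
  obtain ⟨χ, hχs, hχ1, hχ0, hχc⟩ := exists_continuous_sum_one_of_isOpen_isCompact
    (s := fun j => U ∩ u ⁻¹' {z | p (u (e j) - z) < ε}) (fun j => hO _) hK (fun y hy => by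
      obtain ⟨z, hz, hyz⟩ := Set.mem_iUnion₂.1 (hcov hy)
      refine Set.mem_iUnion.2 ⟨e.symm ⟨z, hz⟩, ?_⟩
      rw [Equiv.apply_symm_apply]
      exact hyz)
  refine ⟨_, χ, fun j => u (e j), hχc, fun y hy => ?_⟩
  have h1 : ∑ j, χ j y = 1 := by simpa using hχ1 hy
  have h2 : ∑ j, χ j y • u (e j) - u y = ∑ j, χ j y • (u (e j) - u y) := by
    simp only [smul_sub, Finset.sum_sub_distrib, ← Finset.sum_smul, h1, one_smul]
  rw [h2]
  calc p (∑ j, χ j y • (u (e j) - u y)) ≤ ∑ j, p (χ j y • (u (e j) - u y)) := by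
        exact Finset.le_sum_of_subadditive _ (map_zero p).le (map_add_le_add p) _ _
    _ ≤ ∑ j, χ j y * ε := by
        refine Finset.sum_le_sum fun j _ => ?_
        rw [map_smul_eq_mul, Real.norm_of_nonneg (hχ0 j y).1]
        by_cases h : y ∈ tsupport (χ j)
        · exact mul_le_mul_of_nonneg_left (hχs j h).2.le (hχ0 j y).1
        · rw [image_eq_zero_of_notMem_tsupport h, zero_mul, zero_mul]
    _ = ε := by rw [← Finset.sum_mul, h1, one_mul]

/-- The value `(ψ ⋆ g) x` depends only on `g` on `x - supp ψ`, and it is Lipschitz in the uniform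
norm of `g` there, with the `L^1`-norm of `ψ` as a constant. -/
theorem abs_realConv_sub_le {ψ g h : (Fin d → ℝ) → ℝ} (hψ : Continuous ψ)
    (hc : HasCompactSupport ψ) (hg : LocallyIntegrable g volume) (hh : LocallyIntegrable h volume)
    {x : Fin d → ℝ} {ε : ℝ} (H : ∀ y, ψ y ≠ 0 → |g (x - y) - h (x - y)| ≤ ε) :
    |realConv ψ g x - realConv ψ h x| ≤ ε * ∫ y, |ψ y| := by
  rw [realConv_apply, realConv_apply,
    ← integral_sub (integrable_mul_sub hψ hc hg x) (integrable_mul_sub hψ hc hh x),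
    ← integral_const_mul]
  rw [← Real.norm_eq_abs]
  refine norm_integral_le_of_norm_le
    (((hψ.integrable_of_hasCompactSupport (μ := volume) hc).norm).const_mul ε)
    (Eventually.of_forall fun y => ?_)
  rw [← mul_sub, norm_mul, mul_comm]
  by_cases hy : ψ y = 0
  · simp [hy]
  · exact mul_le_mul_of_nonneg_right (H y hy) (norm_nonneg _)

theorem wordDeriv_eq_zero_of_notMem_closedBall {φ : (Fin d → ℝ) → ℝ} {δ : ℝ}
    (hsupp : ∀ y ∉ Metric.closedBall (0 : Fin d → ℝ) δ, φ y = 0) (w : List (Fin d)) :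
    ∀ y ∉ Metric.closedBall (0 : Fin d → ℝ) δ, wordDeriv w φ y = 0 := by
  induction w with
  | nil => exact hsupp
  | cons i w ih =>
    intro y hy
    have h : wordDeriv w φ =ᶠ[𝓝 y] fun _ => 0 := by
      filter_upwards [Metric.isClosed_closedBall.isOpen_compl.mem_nhds hy] with z hz using ih z hz
    change fderiv ℝ (wordDeriv w φ) y (Pi.single i 1) = 0
    rw [h.fderiv_eq]
    simp

namespace CEll

variable {R : Set (Fin d → ℝ)} {hR : R ⊆ closure (interior R)} {ℓ : ℕ∞}

theorem isPartialExtension_of_contDiff {ψ : (Fin d → ℝ) → ℝ} (hψ : ContDiff ℝ ∞ ψ)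
    (α : Fin d → ℕ) : IsPartialExtension α (⟨fun x : R => ψ x, by fun_prop⟩ : C(R, ℝ))
      ⟨fun x : R => wordDeriv (multiIndexWord α) ψ x,
        (hψ.wordDeriv _).continuous.comp continuous_subtype_val⟩ := by
  refine (hψ.hasIteratedPartialOn (interior R) (multiIndexWord α)).congr ?_ ?_
  · exact fun x hx => (extend_val_apply (fun x : R => ψ x) (interior_subset hx)).symm
  · exact fun x hx => (extend_val_apply
      (fun x : R => wordDeriv (multiIndexWord α) ψ x) (interior_subset hx)).symm

variable (R hR ℓ) in
/-- The restriction to `R` of a smooth function on `ℝ^d`. -/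
def ofContDiff (ψ : (Fin d → ℝ) → ℝ) (hψ : ContDiff ℝ ∞ ψ) : CEll R ℓ ℝ hR :=
  ⟨⟨fun x : R => ψ x, hψ.continuous.comp continuous_subtype_val⟩,
    fun α _ => ⟨_, isPartialExtension_of_contDiff hψ α⟩⟩

theorem partialLM_ofContDiff {ψ : (Fin d → ℝ) → ℝ} (hψ : ContDiff ℝ ∞ ψ)
    (α : {α : Fin d → ℕ // ((∑ i, α i : ℕ) : ℕ∞) ≤ ℓ}) (x : R) :
    partialLM α (ofContDiff R hR ℓ ψ hψ) x = wordDeriv (multiIndexWord α.1) ψ x :=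
  DFunLike.congr_fun ((partialFun_spec α (ofContDiff R hR ℓ ψ hψ)).unique hR
    (isPartialExtension_of_contDiff hψ α.1)) x

end CEll

/-- The chain rule for dilations. -/
theorem HasPartialDerivAt.comp_dilation {F : Type*} [AddCommGroup F] [Module ℝ F]
    [TopologicalSpace F] [ContinuousConstSMul ℝ F] {i : Fin d} {f : (Fin d → ℝ) → F} {y : F}
    {t : ℝ} (ht : t ≠ 0) {a z : Fin d → ℝ} (h : HasPartialDerivAt i f y (a + t • (z - a))) :
    HasPartialDerivAt i (fun z => f (a + t • (z - a))) (t • y) z := by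
  have h1 : Tendsto (fun s : ℝ => t * s) (𝓝[≠] 0) (𝓝[≠] 0) := by
    refine tendsto_nhdsWithin_iff.2 ⟨?_, ?_⟩
    · have : Tendsto (fun s : ℝ => t * s) (𝓝 0) (𝓝 (t * 0)) := tendsto_id.const_mul t
      rw [mul_zero] at this
      exact this.mono_left nhdsWithin_le_nhds
    · filter_upwards [self_mem_nhdsWithin] with s hs using mul_ne_zero ht hs
  refine ((Tendsto.comp h h1).const_smul t).congr fun s => ?_
  have h2 : a + t • (z + Pi.single i s - a) = a + t • (z - a) + Pi.single i (t * s) := by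
    rw [← smul_eq_mul t s, Pi.single_smul, add_sub_right_comm, smul_add, add_assoc]
  simp only [Function.comp_apply, h2, smul_smul, mul_inv]
  rw [mul_inv_cancel_left₀ ht]

end Approximation

/-! ### Density of the tensor product in `C^ℓ(R, F)` -/

section Density

open MeasureTheory
open scoped ContDiff Convolution

variable {d : ℕ} {R : Set (Fin d → ℝ)} {F : Type*} [AddCommGroup F] [Module ℝ F]

/-- The dilations `γ(a + t(x - a))` converge to `γ(x)` for `t → 1`, `t < 1`, uniformly on compact
sets. The factor `t ^ n` is the one which the chain rule produces in a derivative of order `n`. -/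
theorem eventually_dilation_sub_lt [TopologicalSpace F] [IsTopologicalAddGroup F]
    [ContinuousSMul ℝ F] {p : Seminorm ℝ F} (hp : Continuous p) (hconv : Convex ℝ R)
    {a : Fin d → ℝ} (ha : a ∈ R) (γ : C(R, F)) (n : ℕ) {K : Set R} (hK : IsCompact K) {ε : ℝ}
    (hε : 0 < ε) : ∀ᶠ t : ℝ in 𝓝[<] 1, ∀ x ∈ K,
      p (t ^ n • Function.extend Subtype.val γ 0 (a + t • ((x : Fin d → ℝ) - a)) - γ x) < ε := by
  -- With `t` clipped to `[0, 1]`, the dilations are defined on `R` for all real `t`.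
  let σ : ℝ → ℝ := fun t => Set.projIcc (0 : ℝ) 1 zero_le_one t
  have hσ : Continuous σ := continuous_subtype_val.comp continuous_projIcc
  have hmem : ∀ (t : ℝ) (x : R), a + σ t • ((x : Fin d → ℝ) - a) ∈ R := fun t x =>
    hconv.add_smul_sub_mem ha x.2 (Set.projIcc (0 : ℝ) 1 zero_le_one t).2
  let m : ℝ × R → R := fun q => ⟨a + σ q.1 • ((q.2 : Fin d → ℝ) - a), hmem q.1 q.2⟩
  have hm : Continuous m := by
    refine Continuous.subtype_mk ?_ _
    fun_prop
  have hH : Continuous fun q : ℝ × R => p (σ q.1 ^ n • γ (m q) - γ q.2) := by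
    fun_prop
  have hσ1 : σ 1 = 1 := by simp [σ]
  have h1 : ∀ᶠ t : ℝ in 𝓝 1, ∀ x ∈ K, p (σ t ^ n • γ (m (t, x)) - γ x) < ε := by
    refine hK.eventually_forall_of_forall_eventually fun x _ => ?_
    refine (hH.tendsto (1, x)).eventually (gt_mem_nhds ?_)
    have : m (1, x) = x := Subtype.ext (by simp [m, hσ1])
    simpa [this, hσ1] using hε
  filter_upwards [nhdsWithin_le_nhds h1, Ioo_mem_nhdsLT (zero_lt_one : (0 : ℝ) < 1)]
    with t ht htI x hx
  have h2 : σ t = t := by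
    have := Set.projIcc_of_mem (zero_le_one : (0 : ℝ) ≤ 1) (Set.Ioo_subset_Icc_self htI)
    exact congrArg Subtype.val this
  have h3 := ht x hx
  have h4 : Function.extend Subtype.val γ 0 (a + t • ((x : Fin d → ℝ) - a)) = γ (m (t, x)) := by
    rw [← extend_val_apply γ (m (t, x)).2]
    simp only [m, h2]
  rw [h4]
  rwa [h2] at h3

theorem eventually_forall_dist_lt [UniformSpace F] [IsUniformAddGroup F] {X : Type*}
    [PseudoMetricSpace X] {p : Seminorm ℝ F} (hp : Continuous p) {K : Set X} (hK : IsCompact K)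
    {u : X → F} (hu : ContinuousOn u K) {ε : ℝ} (hε : 0 < ε) :
    ∀ᶠ δ : ℝ in 𝓝[>] 0, ∀ x ∈ K, ∀ y ∈ K, dist x y < δ → p (u x - u y) < ε := by
  have huc := hK.uniformContinuousOn_of_continuous hu
  have hent : {q : F × F | p (q.1 - q.2) < ε} ∈ uniformity F := by
    rw [uniformity_eq_comap_nhds_zero_swapped]
    refine ⟨{y | p y < ε}, ?_, fun q hq => hq⟩
    exact (hp.tendsto 0).eventually (gt_mem_nhds (by simpa using hε))
  obtain ⟨δ, hδ, h⟩ := (Metric.uniformity_basis_dist.inf_principal (K ×ˢ K)).mem_iff.1 (huc hent)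
  filter_upwards [Ioo_mem_nhdsGT hδ] with δ' hδ' x hx y hy hxy
  exact h (show (x, y) ∈ _ from ⟨hxy.trans hδ'.2, hx, hy⟩)

/-- If `u β`, for `|β| ≤ ℓ`, are the partial derivatives of `u 0` on an open neighbourhood `U` of
the compact set `K`, then finitely many of them are approximated uniformly on `K` by the partial
derivatives of a finite sum of smooth functions times vectors. If `∑ j, χ j • c j` is a uniform
approximation of `u 0`, the sum `∑ j, (φ ⋆ χ j) • c j` does this, where `φ` is a mollifier. First
the radius of `φ` is fixed by the modulus of continuity of the `u α`, then the quality of the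
approximation of `u 0` by the `L^1`-norms of the derivatives of `φ`. The estimates are made for
`l ∘ u β`, uniformly in the functionals `l` dominated by `p`, so that no vector-valued integrals
are needed. -/
theorem exists_smooth_approx [UniformSpace F] [IsUniformAddGroup F] [ContinuousSMul ℝ F]
    [LocallyConvexSpace ℝ F] {ℓ : ℕ∞} {u : (Fin d → ℕ) → (Fin d → ℝ) → F}
    {U K : Set (Fin d → ℝ)} (hU : IsOpen U) (hK : IsCompact K) (hKU : K ⊆ U)
    (hu : ∀ β, ContinuousOn (u β) U)
    (hud : ∀ (α β : Fin d → ℕ) (i : Fin d), ((∑ j, α j : ℕ) : ℕ∞) ≤ ℓ →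
      multiIndexWord α = i :: multiIndexWord β → ∑ j, α j = ∑ j, β j + 1 → ∀ z ∈ U,
        HasPartialDerivAt i (u β) (u α z) z)
    {A : Set {α : Fin d → ℕ // ((∑ i, α i : ℕ) : ℕ∞) ≤ ℓ}} (hA : A.Finite)
    {p : Seminorm ℝ F} (hp : Continuous p) {ε : ℝ} (hε : 0 < ε) :
    ∃ (n : ℕ) (ψ : Fin n → (Fin d → ℝ) → ℝ) (c : Fin n → F), (∀ j, ContDiff ℝ ∞ (ψ j)) ∧
      ∀ α ∈ A, ∀ x ∈ K,
        p (∑ j, wordDeriv (multiIndexWord α.1) (ψ j) x • c j - u α.1 x) ≤ ε := by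
  have hε2 : 0 < ε / 2 := half_pos hε
  obtain ⟨ρ, hρ, hρU⟩ := hK.exists_cthickening_subset_open hU hKU
  set K₁ := Metric.cthickening ρ K
  have hK₁c : IsCompact K₁ := hK.cthickening
  have hKK₁ : K ⊆ K₁ := Metric.self_subset_cthickening _
  -- The balls of radius `δ < ρ / 3` around points of `K` stay inside `K₁`, and the oscillation of
  -- the `u α` on them is less than `ε / 2`.
  obtain ⟨δ, hδu, hδ0, hδρ⟩ := (((eventually_all_finite hA).2 fun α _ =>
    eventually_forall_dist_lt hp hK₁c ((hu α.1).mono hρU) hε2).and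
    (Ioo_mem_nhdsGT (show (0 : ℝ) < ρ / 3 by positivity))).exists
  let b : ContDiffBump (0 : Fin d → ℝ) := ⟨δ / 2, δ, half_pos hδ0, half_lt_self hδ0⟩
  let φ : (Fin d → ℝ) → ℝ := b.normed volume
  have hφ : ContDiff ℝ ∞ φ := b.contDiff_normed
  have hφc : HasCompactSupport φ := b.hasCompactSupport_normed
  have hφs : ∀ y ∉ Metric.closedBall (0 : Fin d → ℝ) δ, φ y = 0 := by
    intro y hy
    by_contra h
    have : y ∈ Function.support φ := h
    rw [b.support_normed_eq] at this
    exact hy (Metric.ball_subset_closedBall this)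
  have hball : ∀ x ∈ K, Metric.closedBall x δ ⊆ K₁ := fun x hx =>
    (Metric.closedBall_subset_cthickening hx δ).trans
      (Metric.cthickening_mono (by linarith) K)
  -- The error `η` in the approximation of `u 0` is magnified by the `L^1`-norms of the derivatives
  -- of `φ`.
  obtain ⟨η, hη, hη0⟩ := (((eventually_all_finite hA).2 fun α _ =>
    (show ∀ᶠ η : ℝ in 𝓝[>] 0, η * ∫ y, |wordDeriv (multiIndexWord α.1) φ y| < ε / 2 by
      have h1 : Tendsto (fun η : ℝ => η * ∫ y, |wordDeriv (multiIndexWord α.1) φ y|) (𝓝 0)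
          (𝓝 (0 * ∫ y, |wordDeriv (multiIndexWord α.1) φ y|)) := tendsto_id.mul_const _
      rw [zero_mul] at h1
      exact nhdsWithin_le_nhds (h1.eventually (gt_mem_nhds hε2)))).and self_mem_nhdsWithin).exists
  obtain ⟨n, χ, c, hχ, hχu⟩ := exists_partition_approx hp hU hK₁c hρU (hu 0) hη0
  have hχi : ∀ j, LocallyIntegrable (χ j) volume := fun j =>
    (χ j).continuous.locallyIntegrable
  refine ⟨n, fun j => realConv φ (χ j), c, fun j => hφ.realConv hφc (hχi j), fun α hα x hx => ?_⟩
  simp only [fun j => wordDeriv_realConv hφ hφc (hχi j) (multiIndexWord α.1)]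
  set ψ := wordDeriv (multiIndexWord α.1) φ
  have hψd : Continuous ψ := (hφ.wordDeriv _).continuous
  have hψc : HasCompactSupport ψ := hφc.wordDeriv _
  rw [← add_halves ε]
  refine Seminorm.le_of_forall_dual_le hp fun l hl => ?_
  have hlu : ∀ β, ContinuousOn (fun z => l (u β z)) K₁ := fun β =>
    l.continuous.comp_continuousOn ((hu β).mono hρU)
  have hli : ∀ β, LocallyIntegrable (K₁.indicator fun z => l (u β z)) volume := fun β =>
    (((hlu β).integrableOn_compact hK₁c).integrable_indicator
      hK₁c.measurableSet).locallyIntegrable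
  let s : (Fin d → ℝ) → ℝ := fun z => ∑ j, χ j z * l (c j)
  have hsc : Continuous s := by fun_prop
  have hs : realConv ψ s x = ∑ j, realConv ψ (χ j) x * l (c j) := by
    simp only [realConv_apply, s, Finset.mul_sum]
    rw [integral_finsetSum]
    · refine Finset.sum_congr rfl fun j _ => ?_
      rw [← integral_mul_const]
      simp only [mul_assoc]
    · intro j _
      refine ((integrable_mul_sub hψd hψc (hχi j) x).mul_const (l (c j))).congr
        (Eventually.of_forall fun y => ?_)
      exact mul_assoc _ _ _
  -- The derivative of the approximation is `ψ ⋆ s`. It is compared with `ψ ⋆ (l ∘ u 0)`, which is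
  -- `φ ⋆ (l ∘ u α)`, and then with `l ∘ u α`.
  have h1 : |realConv ψ s x - realConv ψ (K₁.indicator fun z => l (u 0 z)) x| ≤ ε / 2 := by
    refine (abs_realConv_sub_le hψd hψc hsc.locallyIntegrable (hli 0) (ε := η)
      fun y hy => ?_).trans (hη α hα).le
    have hyB : y ∈ Metric.closedBall (0 : Fin d → ℝ) δ := by
      by_contra h
      exact hy (wordDeriv_eq_zero_of_notMem_closedBall hφs _ y h)
    have hxy : x - y ∈ K₁ := hball x hx (by
      rw [mem_closedBall_zero_iff] at hyB
      rwa [mem_closedBall_iff_norm, sub_sub_cancel_left, norm_neg])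
    rw [Set.indicator_of_mem hxy]
    have h2 := (hl _).trans (hχu _ hxy)
    simpa [s, map_sum] using h2
  have h2 : realConv ψ (K₁.indicator fun z => l (u 0 z)) x =
      realConv φ (K₁.indicator fun z => l (u α.1 z)) x := by
    refine realConv_wordDeriv_eq (u := fun β z => l (u β z)) (V := Metric.thickening ρ K)
      (W := Metric.thickening (ρ / 3) K) Metric.isOpen_thickening hK₁c
      (Metric.thickening_subset_cthickening _ _) Metric.isOpen_thickening (fun β _ => hlu β)
      (fun α β i hα hw hsum z hz => (hud α β i hα hw hsum z
        (hρU (Metric.thickening_subset_cthickening _ _ hz))).clm_comp l)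
      hφ hφc hφs (r := ρ / 3) hδρ (fun z hz y hy => ?_) α.2
      (Metric.self_subset_thickening (by positivity) _ hx)
    obtain ⟨q, hq, hzq⟩ := Metric.mem_thickening_iff.1 hz
    refine Metric.mem_thickening_iff.2 ⟨q, hq, ?_⟩
    have := dist_triangle y z q
    rw [Metric.mem_closedBall] at hy
    linarith
  have h3 : |realConv φ (K₁.indicator fun z => l (u α.1 z)) x - l (u α.1 x)| ≤ ε / 2 := by
    have h4 := ContDiffBump.dist_normed_convolution_le (φ := b) (μ := volume)
      (x₀ := x) (ε := ε / 2) (hli α.1).aestronglyMeasurable (fun y hy => by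
        have hyK : y ∈ K₁ := hball x hx (Metric.ball_subset_closedBall hy)
        rw [Set.indicator_of_mem hyK, Set.indicator_of_mem (hKK₁ hx), Real.dist_eq, ← map_sub]
        exact (hl _).trans (hδu α hα y hyK x (hKK₁ hx) hy).le)
    rw [Set.indicator_of_mem (hKK₁ hx)] at h4
    exact h4
  rw [← h2] at h3
  have h5 : l (∑ j, realConv ψ (χ j) x • c j - u α.1 x) = realConv ψ s x - l (u α.1 x) := by
    rw [map_sub, map_sum, hs]
    simp only [map_smul, smul_eq_mul]
  rw [h5]
  exact (abs_sub_le _ _ _).trans (add_le_add h1 h3)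

namespace CEll

variable [UniformSpace F] [IsUniformAddGroup F] [ContinuousSMul ℝ F] [T2Space F]
  [LocallyConvexSpace ℝ F] {hR : R ⊆ closure (interior R)} {ℓ : ℕ∞}

omit [LocallyConvexSpace ℝ F] in
theorem partialLM_ofTensor_tmul (α : {α : Fin d → ℕ // ((∑ i, α i : ℕ) : ℕ∞) ≤ ℓ}) (v : F)
    (γ : CEll R ℓ ℝ hR) (x : R) :
    partialLM α (ofTensor (v ⊗ₜ[ℝ] γ)) x = partialLM α γ x • v := by
  rw [ofTensor_tmul, partialLM_postcomp]
  rfl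

/-- A slight dilation `x ↦ f(a + t(x - a))` towards an interior point `a` is close to `f` and has
partial derivatives on an open neighbourhood of all of `R`, even at boundary points of `R`. There it
is approximated by `exists_smooth_approx`. -/
theorem exists_ofTensor_approx (hconv : Convex ℝ R) (f : CEll R ℓ F hR)
    {A : Set {α : Fin d → ℕ // ((∑ i, α i : ℕ) : ℕ∞) ≤ ℓ}} (hA : A.Finite) {K : Set R}
    (hK : IsCompact K) {p : Seminorm ℝ F} (hp : Continuous p) {ε : ℝ} (hε : 0 < ε) :
    ∃ z : F ⊗[ℝ] CEll R ℓ ℝ hR, ∀ α ∈ A, ∀ x ∈ K,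
      p (partialLM α (ofTensor z) x - partialLM α f x) < ε := by
  rcases K.eq_empty_or_nonempty with rfl | ⟨x₀, hx₀⟩
  · exact ⟨0, fun α _ x hx => hx.elim⟩
  obtain ⟨a, ha⟩ : (interior R).Nonempty := closure_nonempty_iff.1 ⟨x₀, hR x₀.2⟩
  obtain ⟨t, ⟨ht, ht0, ht1⟩⟩ := (((eventually_all_finite hA).2 fun α _ =>
    eventually_dilation_sub_lt hp hconv (interior_subset ha) (partialLM α f) (∑ i, α.1 i) hK
      (half_pos hε)).and (Ioo_mem_nhdsLT (zero_lt_one : (0 : ℝ) < 1))).exists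
  -- The value `0` for `|β| > ℓ` is irrelevant; it lets `β` range over all multi-indices.
  let g : (Fin d → ℕ) → C(R, F) := fun β =>
    if h : ((∑ i, β i : ℕ) : ℕ∞) ≤ ℓ then partialLM ⟨β, h⟩ f else 0
  have hg : ∀ β : {α : Fin d → ℕ // ((∑ i, α i : ℕ) : ℕ∞) ≤ ℓ}, g β.1 = partialLM β f :=
    fun β => dif_pos β.2
  let D : (Fin d → ℝ) → Fin d → ℝ := fun z => a + t • (z - a)
  have hD : Continuous D := by fun_prop
  let U : Set (Fin d → ℝ) := D ⁻¹' interior R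
  have hU : IsOpen U := isOpen_interior.preimage hD
  have hRU : R ⊆ U := fun z hz => hconv.openSegment_interior_self_subset_interior ha hz
    ⟨1 - t, t, by linarith, ht0, by ring, by simp only [D, smul_sub, sub_smul, one_smul]; abel⟩
  let u : (Fin d → ℕ) → (Fin d → ℝ) → F := fun β z =>
    t ^ (∑ i, β i) • Function.extend Subtype.val (g β) 0 (D z)
  have hu : ∀ β, ContinuousOn (u β) U := fun β =>
    (((continuousOn_extend_val (g β)).mono interior_subset).comp hD.continuousOn
      fun _ hz => hz).const_smul (t ^ (∑ i, β i))
  have hud : ∀ (α β : Fin d → ℕ) (i : Fin d), ((∑ j, α j : ℕ) : ℕ∞) ≤ ℓ →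
      multiIndexWord α = i :: multiIndexWord β → ∑ j, α j = ∑ j, β j + 1 → ∀ z ∈ U,
        HasPartialDerivAt i (u β) (u α z) z := by
    intro α β i hα hw hsum z hz
    have hβ : ((∑ j, β j : ℕ) : ℕ∞) ≤ ℓ := by
      refine le_trans ?_ hα
      exact_mod_cast (show ∑ j, β j ≤ ∑ j, α j by omega)
    have h1 := (isPartialExtension_cons_iff hw (partialFun_spec ⟨β, hβ⟩ f)).1
      (partialFun_spec ⟨α, hα⟩ f) (D z) hz
    have h2 := (h1.comp_dilation ht0.ne').const_smul (t ^ (∑ j, β j))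
    rw [smul_smul, ← pow_succ, ← hsum] at h2
    simp only [u, hg ⟨α, hα⟩, hg ⟨β, hβ⟩]
    exact h2
  set K₀ : Set (Fin d → ℝ) := Subtype.val '' K
  have hK₀c : IsCompact K₀ := hK.image continuous_subtype_val
  have hK₀R : K₀ ⊆ R := by
    rintro _ ⟨x, -, rfl⟩
    exact x.2
  obtain ⟨n, ψ, c, hψ, hψu⟩ :=
    exists_smooth_approx hU hK₀c (hK₀R.trans hRU) hu hud hA hp (half_pos hε)
  refine ⟨∑ j, c j ⊗ₜ[ℝ] ofContDiff R hR ℓ (ψ j) (hψ j), fun α hα x hx => ?_⟩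
  have hval : partialLM α (ofTensor (∑ j, c j ⊗ₜ[ℝ] ofContDiff R hR ℓ (ψ j) (hψ j))) x =
      ∑ j, wordDeriv (multiIndexWord α.1) (ψ j) x • c j := by
    rw [map_sum, map_sum, ContinuousMap.sum_apply]
    refine Finset.sum_congr rfl fun j _ => ?_
    rw [partialLM_ofTensor_tmul, partialLM_ofContDiff]
  have hmain := hψu α hα x ⟨x, hx, rfl⟩
  rw [← hval] at hmain
  have hdil : p (u α.1 x - partialLM α f x) < ε / 2 := by
    have := ht α hα x hx
    rw [← hg α] at this ⊢
    exact this
  have h6 := map_add_le_add p (partialLM α (ofTensor (∑ j, c j ⊗ₜ[ℝ] ofContDiff R hR ℓ (ψ j)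
    (hψ j))) x - u α.1 x) (u α.1 x - partialLM α f x)
  rw [sub_add_sub_cancel] at h6
  linarith

theorem denseRange_ofTensor (hconv : Convex ℝ R) :
    DenseRange (ofTensor : F ⊗[ℝ] CEll R ℓ ℝ hR →ₗ[ℝ] CEll R ℓ F hR) := by
  intro f
  -- A neighbourhood of `0` contains one which is given by finitely many conditions that `∂^α h`
  -- maps a compact set `C` to a neighbourhood `V` of `0`. It suffices to treat the union of the sets `C`
  -- and a seminorm whose unit ball is contained in the intersection of the sets `V`.
  let ι := {α : Fin d → ℕ // ((∑ i, α i : ℕ) : ℕ∞) ≤ ℓ} × {K : Set R // IsCompact K} ×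
    {V : Set F // V ∈ 𝓝 (0 : F)}
  let B : ι → Set (CEll R ℓ F hR) := fun q => {h | Set.MapsTo (partialLM q.1 h) q.2.1 q.2.2}
  have hB : Tendsto id (⨅ q, 𝓟 (B q)) (𝓝 (0 : CEll R ℓ F hR)) :=
    tendsto_nhds_zero_iff.2 fun α K hK V hV =>
      mem_iInf_of_mem (⟨α, ⟨K, hK⟩, ⟨V, hV⟩⟩ : ι) (mem_principal_self _)
  refine mem_closure_iff_nhds.2 fun N hN => ?_
  have hN0 : (fun h => h + f) ⁻¹' N ∈ 𝓝 (0 : CEll R ℓ F hR) :=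
    (continuous_add_const f).continuousAt.preimage_mem_nhds (by simpa using hN)
  obtain ⟨T, hT, hTN⟩ := (hasBasis_iInf_principal_finite B).mem_iff.1 (hB hN0)
  obtain ⟨p, hp, hpT⟩ := exists_continuous_seminorm_of_mem_nhds_zero
    ((biInter_mem hT).2 fun (q : ι) _ => q.2.2.2)
  obtain ⟨z, hz⟩ := exists_ofTensor_approx hconv f (hT.image fun q : ι => q.1)
    (hT.isCompact_biUnion fun (q : ι) _ => q.2.1.2) hp one_pos
  refine ⟨ofTensor z, ?_, z, rfl⟩
  have : ofTensor z - f ∈ (fun h => h + f) ⁻¹' N := by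
    refine hTN (Set.mem_iInter₂.2 fun q hq x hx => ?_)
    have h1 := hz q.1 ⟨q, hq, rfl⟩ x (Set.mem_biUnion hq hx)
    have h2 := Set.mem_iInter₂.1 (hpT _ h1) q hq
    rwa [map_sub]
  simpa using this

end CEll

end Density

/-! ### The completion -/

/-- A linear map with dense range which induces the topology, into a complete Hausdorff space,
identifies its target with the completion of its source. -/
theorem exists_equiv_completion_of_isInducing {E G : Type*} [AddCommGroup E] [Module ℝ E]
    [UniformSpace E] [IsUniformAddGroup E] [UniformContinuousConstSMul ℝ E] [AddCommGroup G]
    [Module ℝ G] [UniformSpace G] [IsUniformAddGroup G] [ContinuousConstSMul ℝ G] [T2Space G]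
    [CompleteSpace G] (f : E →ₗ[ℝ] G) (hf : IsInducing f) (hd : DenseRange f) :
    ∃ Λ : G ≃L[ℝ] UniformSpace.Completion E, ∀ z : E, Λ (f z) = z := by
  let P : AbstractCompletion E :=
    { space := G
      coe := f
      uniformStruct := inferInstance
      complete := inferInstance
      separation := inferInstance
      isUniformInducing := AddMonoidHom.isUniformInducing_of_isInducing hf
      dense := hd }
  let e : G ≃ᵤ UniformSpace.Completion E := P.compareEquiv UniformSpace.Completion.cPkg
  have he : ∀ z : E, e (f z) = z := fun z => P.compare_coe UniformSpace.Completion.cPkg z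
  have hec : Continuous e := e.continuous
  refine ⟨{ e with
    map_add' := fun x y => ?_
    map_smul' := fun c x => ?_
    continuous_toFun := e.continuous
    continuous_invFun := e.symm.continuous }, he⟩
  · change e (x + y) = e x + e y
    refine hd.induction_on₂ (isClosed_eq (by fun_prop) (by fun_prop)) (fun z w => ?_) x y
    rw [← map_add, he, he, he, UniformSpace.Completion.coe_add]
  · change e (c • x) = c • e x
    have h0 : Continuous fun y => c • e y := hec.const_smul c
    have h1 : Continuous fun y => e (c • y) := hec.comp (continuous_const_smul c)
    refine hd.induction_on (p := fun y => e (c • y) = c • e y) x (isClosed_eq h1 h0) fun z => ?_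
    have h1 : e (c • f z) = ((c • z : E) : UniformSpace.Completion E) := by
      rw [← map_smul f, he]
    rw [h1, he z]
    exact UniformSpace.Completion.coe_smul c z

end

theorem proposition1p2 {d : ℕ} (R : Set (Fin d → ℝ)) (hconv : Convex ℝ R)
    (hR : R ⊆ closure (interior R)) (ℓ : ℕ∞)
    (F : Type*) [AddCommGroup F] [Module ℝ F] [UniformSpace F] [IsUniformAddGroup F]
    [ContinuousSMul ℝ F] [LocallyConvexSpace ℝ F] [T2Space F] [CompleteSpace F] :
    ∃ Λ : CEll R ℓ F hR ≃L[ℝ] CompletedEpsTensor F (CEll R ℓ ℝ hR),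
      ∀ (v : F) (γ : CEll R ℓ ℝ hR) (x : R),
        Λ.symm (EpsTensor.tmul v γ : CompletedEpsTensor F (CEll R ℓ ℝ hR)) x = γ x • v := by
  let := IsTopologicalAddGroup.rightUniformSpace (CEll R ℓ F hR)
  have : IsUniformAddGroup (CEll R ℓ F hR) := isUniformAddGroup_of_addCommGroup
  have : CompleteSpace (CEll R ℓ F hR) := CEll.completeSpace
  obtain ⟨Λ, hΛ⟩ := exists_equiv_completion_of_isInducing
    (CEll.ofEpsTensor : EpsTensor F (CEll R ℓ ℝ hR) →ₗ[ℝ] CEll R ℓ F hR)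
    CEll.isInducing_ofEpsTensor (CEll.denseRange_ofTensor hconv)
  refine ⟨Λ, fun v γ x => ?_⟩
  rw [← hΛ (EpsTensor.tmul v γ), Λ.symm_apply_apply]
  rfl
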